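/- **Setting.** Let $\mathbf B$ be a C$^*$-bicategory: its categories of 1-morphisms $\mathbf B(\mathcal M,\mathcal N)$ are C$^*$-categories closed under finite direct sums and subobjects, horizontal composition $\otimes$ is bilinear on 2-morphisms with $(t\otimes s)^*=t^*\otimes s^*$, and associators and unitors are unitary (they are suppressed below). Assume that $\mathbf B$ has finite-dimensional centers (every $\mathbf B(\mathcal M,\mathcal M)(\mathbb 1_{\mathcal M},\mathbb 1_{\mathcal M})$ is finite-dimensional) and is rigid: for every 1-morphism $X\in\mathbf B(\mathcal M,\mathcal N)$ there are $\overline X\in\mathbf B(\mathcal N,\mathcal M)$ and $\omega:\mathbb 1_{\mathcal M}\to\overline X\otimes X$, $\overline\omega:\mathbb 1_{\mathcal N}\to X\otimes\overline X$ solving the conjugate equations $$(\overline\omega^{\,*}\otimes 1_X)(1_X\otimes\omega)=1_X,\qquad (1_{\overline X}\otimes\overline\omega^{\,*})(\omega\otimes 1_{\overline X})=1_{\overline X}.$$ **Standard solutions.** A 1-morphism $Y\in\mathbf B(\mathcal M,\mathcal N)$ is connected if $[1_Y\otimes \mathrm{End}(\mathbb 1_{\mathcal M})]\cap[\mathrm{End}(\mathbb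 1_{\mathcal N})\otimes 1_Y]=\mathbb C1_Y$. For connected $Y$ with dual $\overline Y$, a solution $(\gamma,\overline\gamma)$ is standard if $\|\gamma\|^2=\|\overline\gamma\|^2=\inf\|\omega\|\,\|\overline\omega\|$, the infimum being over all solutions $(\omega,\overline\omega)$ for $Y$, $\overline Y$. For general $X$ with dual $\overline X$, a solution is standard if it is of the form $(\bigoplus_i\gamma_i,\bigoplus_i\overline\gamma_i)$ for finite orthogonal decompositions $X=\bigoplus_iX_i$, $\overline X=\bigoplus_i\overline X_i$ with all $X_i$ connected and with $X_i\otimes\overline X_j=0$, $\overline X_j\otimes X_i=0$ for $i\ne j$, where $(\gamma_i,\overline\gamma_i)$ is a standard solution for $X_i$ and $\overline X_i$. **Algebras.** An algebra in $\mathbf B(\mathcal M,\mathcal M)$ is a triple $(A,m,\iota)$ with $m:A\otimes A\to A$, $\iota:\mathbb 1_{\mathcal M}\to A$ associative and unital. It is C$^*$-Frobenius if $(1_A\otimes m)(m^*\otimes 1_A)=m^*m=(m\otimes 1_A)(1_A\otimes m^*)$, and special if $mm^*=1_A$. A C$^*$-Frobenius algebra is standard if it is special and $(m^*\iota,m^*\iota)$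 is a standard solution of the conjugate equations for $A$ (as its own dual). Two algebras $(A,m,\iota)$, $(A',m',\iota')$ in $\mathbf B(\mathcal M,\mathcal M)$ are isomorphic if there is an invertible $s:A\to A'$ with $sm=m'(s\otimes s)$ and $s\iota=\iota'$. **Proposition.** Let $(A,m,\iota)$ be a special C$^*$-Frobenius algebra in $\mathbf B(\mathcal M,\mathcal M)$, and let $\overline X=(A,1_A,m)$ be the $\mathbb 1_{\mathcal M}$-$A$-bimodule given by $A$ with the trivial left action of $\mathbb 1_{\mathcal M}$ and the right action $m$ of $A$. Then there is an invertible $\mathbb 1_{\mathcal M}$-$A$-bimodule map $t:\overline X\to\overline X$ (equivalently, an invertible $t:A\to A$ with $tm=m(t\otimes 1_A)$) such that $$\big((t\otimes (t^{-1})^*)\,m^*\iota,\ (t\otimes (t^{-1})^*)\,m^*\iota\big)$$ is a standard solution of the conjugate equations for $A$. Moreover, $(A,m,\iota)$ is isomorphic to a standard C$^*$-Frobenius algebra. -/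

import Mathlib

/-!
Composition conventions.  Mathlib composes in diagrammatic order.  For `f : X ⟶ Y`, `g : Y ⟶ Z`
in a C*-category, the product usually written `g f` is `f ≫ g`.  For 1-morphisms `X : L ⟶ M` and
`Y : M ⟶ N`, the tensor product usually written `Y ⊗ X` is `X ≫ Y`; hence `1_Y ⊗ s` is `s ▷ Y`
and `t ⊗ 1_X` is `X ◁ t`.
-/

open CategoryTheory Bicategory

universe w v u

namespace CStarBicat

/-! ### C*-categories -/

/-- A C*-category: a complex-linear category whose morphism sets are Banach spaces, with an
antilinear contravariant involution `f ↦ f*` which is the identity on objects, a submultiplicative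
norm satisfying the C*-identity, and `f* f ≥ 0` (that is, `f* f = g* g` for some endomorphism `g`
of the source of `f`). -/
class CStarCategory (C : Type v) [Category.{w} C] where
  homNormed : ∀ X Y : C, NormedAddCommGroup (X ⟶ Y)
  homSpace : ∀ X Y : C, NormedSpace ℂ (X ⟶ Y)
  homComplete : ∀ X Y : C, CompleteSpace (X ⟶ Y)
  add_comp : ∀ {X Y Z : C} (f f' : X ⟶ Y) (g : Y ⟶ Z), (f + f') ≫ g = f ≫ g + f' ≫ g
  comp_add : ∀ {X Y Z : C} (f : X ⟶ Y) (g g' : Y ⟶ Z), f ≫ (g + g') = f ≫ g + f ≫ g'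
  smul_comp : ∀ {X Y Z : C} (c : ℂ) (f : X ⟶ Y) (g : Y ⟶ Z), (c • f) ≫ g = c • (f ≫ g)
  comp_smul : ∀ {X Y Z : C} (f : X ⟶ Y) (c : ℂ) (g : Y ⟶ Z), f ≫ (c • g) = c • (f ≫ g)
  /-- The involution `f ↦ f*`. -/
  dagger : ∀ {X Y : C}, (X ⟶ Y) → (Y ⟶ X)
  dagger_add : ∀ {X Y : C} (f g : X ⟶ Y), dagger (f + g) = dagger f + dagger g
  dagger_smul : ∀ {X Y : C} (c : ℂ) (f : X ⟶ Y), dagger (c • f) = starRingEnd ℂ c • dagger f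
  dagger_dagger : ∀ {X Y : C} (f : X ⟶ Y), dagger (dagger f) = f
  dagger_comp : ∀ {X Y Z : C} (f : X ⟶ Y) (g : Y ⟶ Z), dagger (f ≫ g) = dagger g ≫ dagger f
  norm_comp_le : ∀ {X Y Z : C} (f : X ⟶ Y) (g : Y ⟶ Z), ‖f ≫ g‖ ≤ ‖f‖ * ‖g‖
  norm_comp_dagger : ∀ {X Y : C} (f : X ⟶ Y), ‖f ≫ dagger f‖ = ‖f‖ ^ 2
  comp_dagger_nonneg : ∀ {X Y : C} (f : X ⟶ Y), ∃ g : X ⟶ X, f ≫ dagger f = g ≫ dagger g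

attribute [reducible, instance] CStarCategory.homNormed CStarCategory.homSpace
attribute [instance] CStarCategory.homComplete

postfix:max "†" => CStarCategory.dagger

section CStarCategory

variable (C : Type v) [Category.{w} C] [CStarCategory C]

instance : Preadditive C where
  homGroup X Y := (CStarCategory.homNormed X Y).toAddCommGroup
  add_comp _ _ _ f f' g := CStarCategory.add_comp f f' g
  comp_add _ _ _ f g g' := CStarCategory.comp_add f g g'

instance : Linear ℂ C where
  homModule X Y := (CStarCategory.homSpace X Y).toModule
  smul_comp _ _ _ c f g := CStarCategory.smul_comp c f g
  comp_smul _ _ _ f c g := CStarCategory.comp_smul f c g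

variable {C}

/-- `S` is the (orthogonal) direct sum of the finite family `X`, with inclusions the isometries
`u i : X i ⟶ S`: one has `(u i)* (u i) = 1`, `(u j)* (u i) = 0` for `i ≠ j` and
`∑ i, (u i) (u i)* = 1`. -/
structure IsDirectSum {n : ℕ} (X : Fin n → C) (S : C) (u : ∀ i, X i ⟶ S) : Prop where
  isometry : ∀ i, u i ≫ (u i)† = 𝟙 (X i)
  orthogonal : ∀ i j, i ≠ j → u i ≫ (u j)† = 0
  complete : ∑ i, (u i)† ≫ u i = 𝟙 S

variable (C)

/-- Closure under finite direct sums (the empty one, a zero object, included). -/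
def HasFiniteDirectSums : Prop :=
  ∀ (n : ℕ) (X : Fin n → C), ∃ (S : C) (u : ∀ i, X i ⟶ S), IsDirectSum X S u

/-- Closure under subobjects: every projection `p = p* = p²` is `u u*` for an isometry `u`. -/
def HasSubobjects : Prop :=
  ∀ (X : C) (p : X ⟶ X), p ≫ p = p → p† = p →
    ∃ (Y : C) (u : Y ⟶ X), u ≫ u† = 𝟙 Y ∧ u† ≫ u = p

end CStarCategory

/-! ### C*-bicategories -/

/-- A C*-bicategory: a bicategory whose categories of 1-morphisms are C*-categories closed under
finite direct sums and subobjects, whose horizontal composition is bilinear and compatible with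
the involution, and whose associators and unitors are unitary. -/
class CStarBicategory (B : Type u) [Bicategory.{w, v} B] where
  homCStar : ∀ a b : B, CStarCategory (a ⟶ b)
  directSums : ∀ a b : B, HasFiniteDirectSums (a ⟶ b)
  subobjects : ∀ a b : B, HasSubobjects (a ⟶ b)
  whiskerLeft_add : ∀ {a b c : B} (f : a ⟶ b) {g h : b ⟶ c} (η θ : g ⟶ h),
    f ◁ (η + θ) = f ◁ η + f ◁ θ
  whiskerLeft_smul : ∀ {a b c : B} (f : a ⟶ b) {g h : b ⟶ c} (z : ℂ) (η : g ⟶ h),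
    f ◁ (z • η) = z • (f ◁ η)
  add_whiskerRight : ∀ {a b c : B} {f g : a ⟶ b} (η θ : f ⟶ g) (h : b ⟶ c),
    (η + θ) ▷ h = η ▷ h + θ ▷ h
  smul_whiskerRight : ∀ {a b c : B} {f g : a ⟶ b} (z : ℂ) (η : f ⟶ g) (h : b ⟶ c),
    (z • η) ▷ h = z • (η ▷ h)
  dagger_whiskerLeft : ∀ {a b c : B} (f : a ⟶ b) {g h : b ⟶ c} (η : g ⟶ h),
    (f ◁ η)† = f ◁ η†
  dagger_whiskerRight : ∀ {a b c : B} {f g : a ⟶ b} (η : f ⟶ g) (h : b ⟶ c),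
    (η ▷ h)† = η† ▷ h
  associator_unitary : ∀ {a b c d : B} (f : a ⟶ b) (g : b ⟶ c) (h : c ⟶ d),
    (α_ f g h).hom† = (α_ f g h).inv
  leftUnitor_unitary : ∀ {a b : B} (f : a ⟶ b), (λ_ f).hom† = (λ_ f).inv
  rightUnitor_unitary : ∀ {a b : B} (f : a ⟶ b), (ρ_ f).hom† = (ρ_ f).inv

attribute [reducible, instance] CStarBicategory.homCStar

section Bicategory

variable {B : Type u} [Bicategory.{w, v} B]

/-- The horizontal product `t ⊗ s : Y₁ ⊗ X₁ ⟶ Y₂ ⊗ X₂` of `t : Y₁ ⟶ Y₂` and `s : X₁ ⟶ X₂`. -/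
def hTensor {a b c : B} {Y₁ Y₂ : b ⟶ c} {X₁ X₂ : a ⟶ b} (t : Y₁ ⟶ Y₂) (s : X₁ ⟶ X₂) :
    X₁ ≫ Y₁ ⟶ X₂ ≫ Y₂ :=
  s ▷ Y₁ ≫ X₂ ◁ t

variable [CStarBicategory B]

/-- `(ω, ω')`, with `ω : 1 ⟶ X̄ ⊗ X` and `ω' : 1 ⟶ X ⊗ X̄`, is a solution of the conjugate equations
`(ω'* ⊗ 1_X)(1_X ⊗ ω) = 1_X` and `(1_X̄ ⊗ ω'*)(ω ⊗ 1_X̄) = 1_X̄` for `X` and `X̄`. -/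
structure IsConjugateSolution {M N : B} (X : M ⟶ N) (Xd : N ⟶ M)
    (ω : 𝟙 M ⟶ X ≫ Xd) (ω' : 𝟙 N ⟶ Xd ≫ X) : Prop where
  left : (λ_ X).inv ≫ ω ▷ X ≫ (α_ X Xd X).hom ≫ X ◁ ω'† ≫ (ρ_ X).hom = 𝟙 X
  right : (ρ_ Xd).inv ≫ Xd ◁ ω ≫ (α_ Xd X Xd).inv ≫ ω'† ▷ Xd ≫ (λ_ Xd).hom = 𝟙 Xd

variable (B) in
/-- Rigidity: every 1-morphism has a dual. -/
def IsRigid : Prop :=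
  ∀ {M N : B} (X : M ⟶ N), ∃ (Xd : N ⟶ M) (ω : 𝟙 M ⟶ X ≫ Xd) (ω' : 𝟙 N ⟶ Xd ≫ X),
    IsConjugateSolution X Xd ω ω'

variable (B) in
/-- Finite-dimensional centers. -/
def HasFiniteDimensionalCenters : Prop :=
  ∀ M : B, FiniteDimensional ℂ (𝟙 M ⟶ 𝟙 M)

/-! ### Standard solutions of the conjugate equations -/

/-- `Y` is connected: `[1_Y ⊗ End(1_M)] ∩ [End(1_N) ⊗ 1_Y] = ℂ 1_Y` in `End(Y)`. -/
def IsConnected {M N : B} (Y : M ⟶ N) : Prop :=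
  Set.range (fun z : 𝟙 M ⟶ 𝟙 M => (λ_ Y).inv ≫ z ▷ Y ≫ (λ_ Y).hom) ∩
      Set.range (fun z : 𝟙 N ⟶ 𝟙 N => (ρ_ Y).inv ≫ Y ◁ z ≫ (ρ_ Y).hom) =
    Set.range (fun c : ℂ => c • 𝟙 Y)

/-- `(γ, γ')` is a standard solution for the connected 1-morphism `Y` with dual `Yd`: it is a
solution with `‖γ‖² = ‖γ'‖² = inf ‖ω‖ ‖ω'‖`, the infimum over all solutions `(ω, ω')`. -/
structure IsStandardConnected {M N : B} (Y : M ⟶ N) (Yd : N ⟶ M)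
    (γ : 𝟙 M ⟶ Y ≫ Yd) (γ' : 𝟙 N ⟶ Yd ≫ Y) : Prop where
  connected : IsConnected Y
  solution : IsConjugateSolution Y Yd γ γ'
  norm_sq_eq : ‖γ‖ ^ 2 = ‖γ'‖ ^ 2
  norm_sq_isGLB : IsGLB {x : ℝ | ∃ (ω : 𝟙 M ⟶ Y ≫ Yd) (ω' : 𝟙 N ⟶ Yd ≫ Y),
    IsConjugateSolution Y Yd ω ω' ∧ x = ‖ω‖ * ‖ω'‖} (‖γ‖ ^ 2)

/-- `(γ, γ')` is a standard solution for `X` with dual `Xd`: it is a solution, there are orthogonal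
decompositions `X = ⊕ Xᵢ`, `X̄ = ⊕ X̄ᵢ` with all `Xᵢ` connected and `Xᵢ ⊗ X̄ⱼ = 0`, `X̄ⱼ ⊗ Xᵢ = 0` for
`i ≠ j`, and `γ = ⊕ γᵢ`, `γ' = ⊕ γ'ᵢ` with `(γᵢ, γ'ᵢ)` standard for `Xᵢ` and `X̄ᵢ`. -/
def IsStandardSolution {M N : B} (X : M ⟶ N) (Xd : N ⟶ M)
    (γ : 𝟙 M ⟶ X ≫ Xd) (γ' : 𝟙 N ⟶ Xd ≫ X) : Prop :=
  IsConjugateSolution X Xd γ γ' ∧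
  ∃ (n : ℕ) (Y : Fin n → (M ⟶ N)) (Yd : Fin n → (N ⟶ M))
    (u : ∀ i, Y i ⟶ X) (ud : ∀ i, Yd i ⟶ Xd)
    (g : ∀ i, 𝟙 M ⟶ Y i ≫ Yd i) (g' : ∀ i, 𝟙 N ⟶ Yd i ≫ Y i),
    IsDirectSum Y X u ∧ IsDirectSum Yd Xd ud ∧
    (∀ i j, i ≠ j → Limits.IsZero (Yd j ≫ Y i) ∧ Limits.IsZero (Y i ≫ Yd j)) ∧
    (∀ i, IsStandardConnected (Y i) (Yd i) (g i) (g' i)) ∧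
    γ = ∑ i, g i ≫ hTensor (ud i) (u i) ∧
    γ' = ∑ i, g' i ≫ hTensor (u i) (ud i)

end Bicategory

/-! ### Algebras and bimodules -/

section Algebra

variable {B : Type u} [Bicategory.{w, v} B]

/-- An algebra `(A, m, ι)` in `B(M, M)`. -/
structure Alg (M : B) where
  obj : M ⟶ M
  mul : obj ≫ obj ⟶ obj
  one : 𝟙 M ⟶ obj
  /-- `m (ι ⊗ 1_A) = 1_A` -/
  one_mul : obj ◁ one ≫ mul = (ρ_ obj).hom
  /-- `m (1_A ⊗ ι) = 1_A` -/
  mul_one : one ▷ obj ≫ mul = (λ_ obj).hom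
  /-- `m (m ⊗ 1_A) = m (1_A ⊗ m)` -/
  mul_assoc : mul ▷ obj ≫ mul = (α_ obj obj obj).hom ≫ obj ◁ mul ≫ mul

namespace Alg

/-- `t` is an algebra homomorphism: `t m = m' (t ⊗ t)` and `t ι = ι'`. -/
structure IsHom {M : B} (A A' : Alg M) (t : A.obj ⟶ A'.obj) : Prop where
  mul : A.mul ≫ t = hTensor t t ≫ A'.mul
  one : A.one ≫ t = A'.one

/-- Isomorphism of algebras: there is an invertible algebra homomorphism. -/
def Isomorphic {M : B} (A A' : Alg M) : Prop :=
  ∃ t : A.obj ≅ A'.obj, IsHom A A' t.hom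

/-- The horizontal unit `1_M` as an algebra. -/
def unit (M : B) : Alg M where
  obj := 𝟙 M
  mul := (λ_ (𝟙 M)).hom
  one := 𝟙 (𝟙 M)
  one_mul := by simp [unitors_equal]
  mul_one := by simp
  mul_assoc := by simp [unitors_equal]

end Alg

/-- A `B`-`A`-bimodule `(X, l, r)` for algebras `A` in `B(M, M)` and `B` in `B(N, N)`. -/
structure Bimod {M N : B} (Bl : Alg N) (A : Alg M) where
  obj : M ⟶ N
  /-- the left action `B ⊗ X ⟶ X` -/
  l : obj ≫ Bl.obj ⟶ obj
  /-- the right action `X ⊗ A ⟶ X` -/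
  r : A.obj ≫ obj ⟶ obj
  /-- `l (m_B ⊗ 1_X) = l (1_B ⊗ l)` -/
  l_assoc : l ▷ Bl.obj ≫ l = (α_ obj Bl.obj Bl.obj).hom ≫ obj ◁ Bl.mul ≫ l
  /-- `r (1_X ⊗ m_A) = r (r ⊗ 1_A)` -/
  r_assoc : A.mul ▷ obj ≫ r = (α_ A.obj A.obj obj).hom ≫ A.obj ◁ r ≫ r
  /-- `l (ι_B ⊗ 1_X) = 1_X` -/
  l_one : obj ◁ Bl.one ≫ l = (ρ_ obj).hom
  /-- `r (1_X ⊗ ι_A) = 1_X` -/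
  r_one : A.one ▷ obj ≫ r = (λ_ obj).hom
  /-- `r (l ⊗ 1_A) = l (1_B ⊗ r)` -/
  l_r : r ▷ Bl.obj ≫ l = (α_ A.obj obj Bl.obj).hom ≫ A.obj ◁ l ≫ r

/-- `f` is a bimodule map: `f l₁ = l₂ (1_B ⊗ f)` and `f r₁ = r₂ (f ⊗ 1_A)`. -/
structure Bimod.IsMap {M N : B} {Bl : Alg N} {A : Alg M} (X₁ X₂ : Bimod Bl A)
    (f : X₁.obj ⟶ X₂.obj) : Prop where
  left : X₁.l ≫ f = f ▷ Bl.obj ≫ X₂.l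
  right : X₁.r ≫ f = A.obj ◁ f ≫ X₂.r

namespace Alg

/-- The `1_M`-`A`-bimodule `(A, 1_A, m)`. -/
def rightBimod {M : B} (A : Alg M) : Bimod (unit M) A where
  obj := A.obj
  l := (ρ_ A.obj).hom
  r := A.mul
  l_assoc := by simp [unit]
  r_assoc := A.mul_assoc
  l_one := by simp [unit]
  r_one := A.mul_one
  l_r := by simp [unit]

variable [CStarBicategory B] {M : B}

/-- A C*-Frobenius algebra: `(1_A ⊗ m)(m* ⊗ 1_A) = m* m = (m ⊗ 1_A)(1_A ⊗ m*)`. -/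
structure IsCStarFrobenius (A : Alg M) : Prop where
  left : A.obj ◁ A.mul† ≫ (α_ A.obj A.obj A.obj).inv ≫ A.mul ▷ A.obj = A.mul ≫ A.mul†
  right : A.mul† ▷ A.obj ≫ (α_ A.obj A.obj A.obj).hom ≫ A.obj ◁ A.mul = A.mul ≫ A.mul†

/-- A special algebra: `m m* = 1_A`. -/
def IsSpecial (A : Alg M) : Prop :=
  A.mul† ≫ A.mul = 𝟙 A.obj

/-- A standard C*-Frobenius algebra: it is special, and `(m* ι, m* ι)` is a standard solution of
the conjugate equations for `A`. -/
structure IsStandard (A : Alg M) : Prop where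
  frobenius : A.IsCStarFrobenius
  special : A.IsSpecial
  standard : IsStandardSolution A.obj A.obj (A.one ≫ A.mul†) (A.one ≫ A.mul†)

/-- The twisted 2-morphism `(t ⊗ (t⁻¹)*) m* ι : 1 ⟶ A ⊗ A`. -/
def twisted (A : Alg M) (t : A.obj ≅ A.obj) : 𝟙 M ⟶ A.obj ≫ A.obj :=
  A.one ≫ A.mul† ≫ hTensor t.hom (t.inv)†

end Alg

end Algebra

end CStarBicat

/-!
The infimum in the definition of a standard solution is reached by a solution whose two partial
traces agree under a suitable state, and the special algebra structures on `A` obtained from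
the given one by right linear twists always contain one with this property.

*Minimality from traces.* Let `(g, g')` be a solution for `Y`, and let `φ` be a state on
`End(1_M)` with `φ(g* g) = ‖g‖²` and `φ(g* (1 ⊗ T) g) = φ(g'* (T ⊗ 1) g')` for all `T ∈ End(Y)`.
For any other solution `(ω, ω')` there is `s ∈ End(Y)` with `(1 ⊗ s) ω = g` and `(s* ⊗ 1) g' = ω'`.
The Cauchy-Schwarz inequality for `φ` bounds `φ(g* g) = φ(((1 ⊗ s*) g)* ω)`, and the trace condition
identifies the squared length of `(1 ⊗ s*) g` with that of `ω'`, so `‖g‖² ≤ ‖ω‖ ‖ω'‖`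
(`IsConjugateSolution.norm_sq_le`).

*The trace condition for an algebra.* For `(m* ι, m* ι)` the two partial traces of `T` are
`ι* m (T ⊗ 1) m* ι` and `ι* m (1 ⊗ T) m* ι`. By associativity and the Frobenius relations they
agree under `φ` for all `T` as soon as `φ(ι* x ι) = φ(ι* m (1 ⊗ x) m* ι)` for all `x` in the algebra
`E` of right linear endomorphisms, those with `x m = m (x ⊗ 1)`
(`Alg.IsBalancingState.rightAverage_eq_leftAverage`).

*Existence of the state.* An invertible `t ∈ E` with inverse `v` transports the algebra structure to
`(m (1 ⊗ v), t ι)`, which is again C*-Frobenius, is special when `m (1 ⊗ v v*) m* = 1`, and has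
`m'* ι' = (t ⊗ (t⁻¹)*) m* ι`. The space `E` is finite-dimensional, since its elements `x` are
determined by `x ι` and `Hom(1, A)` is finite-dimensional
(`IsConjugateSolution.finiteDimensional`). So some special twist `t` makes the norm of `t ι`
minimal (`Alg.exists_optimal_twist`). Replacing the algebra by the transported one, the optimum is
at `t = 1`. Perturbing by `(1 + δ s)^(-1/2)`, with `s ∈ E` selfadjoint and `m (1 ⊗ s) m* = 0`,
shows that some character `χ` of `End(1_M)` attaining `‖ι* ι‖` satisfies `χ(ι* s ι) ≤ 0`
(`Alg.exists_char_nonpos`). By Gordan's alternative a convex combination `φ` of such characters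
vanishes on all `ι* s ι`, and this is the trace condition for `x - m (1 ⊗ x) m*`.

*Connected components.* The elements of `End(1_M)` acting on `A` in the same way from both sides
form a finite-dimensional commutative C*-algebra. Its minimal projections `z i` decompose `A` into
connected summands `Y i` with `Y i ⊗ Y j = 0` for `i ≠ j`. The quantity minimised is
`∑ i, ‖t ι z i‖`, so each component is optimal and has its own balancing state.
-/

namespace CStarBicat

/-! ### Right and left linear endomorphisms of an algebra -/

section Dagger

variable {C : Type v} [Category.{w} C] [CStarCategory C]

@[simp]
lemma dagger_id (X : C) : (𝟙 X)† = 𝟙 X := by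
  have h := CStarCategory.dagger_comp (𝟙 X) ((𝟙 X)†)
  rw [Category.id_comp, CStarCategory.dagger_dagger, Category.id_comp] at h
  exact h.symm

@[simp]
lemma dagger_zero (X Y : C) : (0 : X ⟶ Y)† = 0 := by
  have h := CStarCategory.dagger_add (0 : X ⟶ Y) 0
  rw [add_zero] at h
  exact left_eq_add.mp h

end Dagger

section Bicategory

variable {B : Type u} [Bicategory.{w, v} B] [CStarBicategory B]

@[simp]
lemma dagger_leftUnitor_inv {a b : B} (f : a ⟶ b) : (λ_ f).inv† = (λ_ f).hom := by
  rw [← CStarBicategory.leftUnitor_unitary, CStarCategory.dagger_dagger]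

@[simp]
lemma dagger_rightUnitor_inv {a b : B} (f : a ⟶ b) : (ρ_ f).inv† = (ρ_ f).hom := by
  rw [← CStarBicategory.rightUnitor_unitary, CStarCategory.dagger_dagger]

attribute [simp] CStarCategory.dagger_dagger CStarCategory.dagger_comp
  CStarBicategory.dagger_whiskerLeft CStarBicategory.dagger_whiskerRight
  CStarBicategory.associator_unitary CStarBicategory.leftUnitor_unitary
  CStarBicategory.rightUnitor_unitary

end Bicategory

namespace Alg

section Linear

variable {B : Type u} [Bicategory.{w, v} B] {M : B} {A : Alg M}

variable (A) in
/-- `x` commutes with the right multiplication of `A` on itself: `x m = m (x ⊗ 1_A)`. -/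
def IsRightLinear (x : A.obj ⟶ A.obj) : Prop := A.mul ≫ x = A.obj ◁ x ≫ A.mul

variable (A) in
/-- `x` commutes with the left multiplication of `A` on itself: `x m = m (1_A ⊗ x)`. -/
def IsLeftLinear (x : A.obj ⟶ A.obj) : Prop := A.mul ≫ x = x ▷ A.obj ≫ A.mul

lemma IsRightLinear.comp {x y : A.obj ⟶ A.obj} (hx : A.IsRightLinear x) (hy : A.IsRightLinear y) :
    A.IsRightLinear (x ≫ y) := by
  unfold IsRightLinear at *
  rw [reassoc_of% hx, hy]; simp

variable (A) in
/-- The left multiplication `m (ξ ⊗ 1_A)` by the element `ξ : 1 ⟶ A`. -/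
def leftMul (ξ : 𝟙 M ⟶ A.obj) : A.obj ⟶ A.obj := (ρ_ A.obj).inv ≫ A.obj ◁ ξ ≫ A.mul

lemma isRightLinear_leftMul (ξ : 𝟙 M ⟶ A.obj) : A.IsRightLinear (A.leftMul ξ) := by
  have h2 := A.mul_assoc
  rw [← Iso.inv_comp_eq] at h2
  calc A.mul ≫ A.leftMul ξ = (ρ_ _).inv ≫ (A.mul ▷ _ ≫ A.obj ◁ ξ) ≫ A.mul := by
        simp [leftMul]
    _ = (ρ_ _).inv ≫ (A.obj ≫ A.obj) ◁ ξ ≫ A.mul ▷ A.obj ≫ A.mul := by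
        rw [← whisker_exchange]; simp
    _ = A.obj ◁ ((ρ_ _).inv ≫ A.obj ◁ ξ) ≫ (α_ _ _ _).inv ≫ A.mul ▷ A.obj ≫ A.mul := by
        simp
    _ = _ := by rw [h2]; simp [leftMul]

lemma IsRightLinear.leftMul_eq {x : A.obj ⟶ A.obj} (hx : A.IsRightLinear x) :
    A.leftMul (A.one ≫ x) = x := by
  have hx : A.mul ≫ x = A.obj ◁ x ≫ A.mul := hx
  rw [leftMul, whiskerLeft_comp, Category.assoc, ← hx, reassoc_of% A.one_mul]
  simp

lemma one_leftMul (ξ : 𝟙 M ⟶ A.obj) : A.one ≫ A.leftMul ξ = ξ := by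
  calc A.one ≫ A.leftMul ξ = (ρ_ _).inv ≫ (A.one ▷ _ ≫ A.obj ◁ ξ) ≫ A.mul := by simp [leftMul]
    _ = (ρ_ _).inv ≫ _ ◁ ξ ≫ (λ_ A.obj).hom := by
      rw [← whisker_exchange, Category.assoc, A.mul_one]
    _ = ξ := by simp

lemma IsRightLinear.eq_of_one {x y : A.obj ⟶ A.obj} (hx : A.IsRightLinear x)
    (hy : A.IsRightLinear y) (h : A.one ≫ x = A.one ≫ y) : x = y := by
  rw [← hx.leftMul_eq, ← hy.leftMul_eq, h]

variable (A) in
/-- The algebra transported along the invertible right linear map `t`, with inverse `v`. Since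
`t m (v ⊗ v) = m (1_A ⊗ v)` by right linearity, the new multiplication needs only one factor `v`. -/
def transport (t v : A.obj ⟶ A.obj) (ht : A.IsRightLinear t) (hv : A.IsRightLinear v)
    (hvt : v ≫ t = 𝟙 _) (htv : t ≫ v = 𝟙 _) : Alg M where
  obj := A.obj
  mul := v ▷ A.obj ≫ A.mul
  one := A.one ≫ t
  one_mul := by
    have ht : A.mul ≫ t = A.obj ◁ t ≫ A.mul := ht
    rw [← Category.assoc, whisker_exchange, whiskerLeft_comp]
    simp only [Category.assoc]
    rw [← ht, reassoc_of% A.one_mul]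
    simp [hvt]
  mul_one := by
    rw [← comp_whiskerRight_assoc, Category.assoc, htv, Category.comp_id, A.mul_one]
  mul_assoc := by
    have hv : A.mul ≫ v = A.obj ◁ v ≫ A.mul := hv
    calc _ = (v ▷ A.obj ≫ (A.mul ≫ v)) ▷ A.obj ≫ A.mul := by simp
      _ = v ▷ A.obj ▷ A.obj ≫ (A.obj ◁ v) ▷ A.obj ≫ A.mul ▷ A.obj ≫ A.mul := by
        rw [hv]; simp
      _ = (α_ _ _ _).hom ≫ (v ▷ (A.obj ≫ A.obj) ≫ A.obj ◁ v ▷ A.obj) ≫ A.obj ◁ A.mul ≫ A.mul := by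
        rw [A.mul_assoc]; simp
      _ = (α_ _ _ _).hom ≫ A.obj ◁ v ▷ A.obj ≫ (v ▷ (A.obj ≫ A.obj) ≫ A.obj ◁ A.mul) ≫ A.mul := by
        rw [← whisker_exchange]; simp
      _ = _ := by
        rw [← whisker_exchange]; simp

end Linear

variable {B : Type u} [Bicategory.{w, v} B] [CStarBicategory B] {M : B} {A : Alg M}

variable (A) in
/-- The map `T ↦ m (T ⊗ 1_A) m*`. For a special C*-Frobenius algebra it is an idempotent
map of `End(A)` onto the right linear endomorphisms. -/
def rightAverage (T : A.obj ⟶ A.obj) : A.obj ⟶ A.obj := A.mul† ≫ A.obj ◁ T ≫ A.mul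

variable (A) in
/-- The map `T ↦ m (1_A ⊗ T) m*`. For a special C*-Frobenius algebra it is an idempotent
map of `End(A)` onto the left linear endomorphisms. -/
def leftAverage (T : A.obj ⟶ A.obj) : A.obj ⟶ A.obj := A.mul† ≫ T ▷ A.obj ≫ A.mul

lemma dagger_rightAverage (T : A.obj ⟶ A.obj) : (A.rightAverage T)† = A.rightAverage (T†) := by
  simp [rightAverage]

lemma dagger_leftAverage (T : A.obj ⟶ A.obj) : (A.leftAverage T)† = A.leftAverage (T†) := by
  simp [leftAverage]

lemma IsRightLinear.rightAverage_eq (hs : A.IsSpecial) {x : A.obj ⟶ A.obj}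
    (hx : A.IsRightLinear x) :
    A.rightAverage x = x := by
  have hs : A.mul† ≫ A.mul = 𝟙 A.obj := hs
  rw [rightAverage, ← hx, reassoc_of% hs]

lemma IsLeftLinear.leftAverage_eq (hs : A.IsSpecial) {x : A.obj ⟶ A.obj} (hx : A.IsLeftLinear x) :
    A.leftAverage x = x := by
  have hs : A.mul† ≫ A.mul = 𝟙 A.obj := hs
  rw [leftAverage, ← hx, reassoc_of% hs]

lemma IsCStarFrobenius.isRightLinear_rightAverage (hA : A.IsCStarFrobenius) (T : A.obj ⟶ A.obj) :
    A.IsRightLinear (A.rightAverage T) := by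
  have h1 := hA.left
  have h2 := A.mul_assoc
  calc A.mul ≫ A.rightAverage T = (A.mul ≫ A.mul†) ≫ A.obj ◁ T ≫ A.mul := by simp [rightAverage]
    _ = A.obj ◁ A.mul† ≫ (α_ A.obj A.obj A.obj).inv ≫ (A.mul ▷ A.obj ≫ A.obj ◁ T) ≫ A.mul := by
      rw [← h1]; simp
    _ = A.obj ◁ A.mul† ≫ A.obj ◁ A.obj ◁ T ≫ (α_ A.obj A.obj A.obj).inv ≫
        A.mul ▷ A.obj ≫ A.mul := by
      rw [← whisker_exchange]; simp
    _ = _ := by rw [h2]; simp [rightAverage]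

lemma IsCStarFrobenius.isLeftLinear_leftAverage (hA : A.IsCStarFrobenius) (T : A.obj ⟶ A.obj) :
    A.IsLeftLinear (A.leftAverage T) := by
  have h1 := hA.right
  have h2 := A.mul_assoc
  calc A.mul ≫ A.leftAverage T = (A.mul ≫ A.mul†) ≫ T ▷ A.obj ≫ A.mul := by simp [leftAverage]
    _ = A.mul† ▷ A.obj ≫ (α_ A.obj A.obj A.obj).hom ≫ (A.obj ◁ A.mul ≫ T ▷ A.obj) ≫ A.mul := by
      rw [← h1]; simp
    _ = A.mul† ▷ A.obj ≫ T ▷ A.obj ▷ A.obj ≫ (α_ A.obj A.obj A.obj).hom ≫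
        A.obj ◁ A.mul ≫ A.mul := by
      rw [whisker_exchange]; simp
    _ = _ := by rw [← h2]; simp [leftAverage]

lemma IsCStarFrobenius.isRightLinear_leftAverage (hA : A.IsCStarFrobenius) {x : A.obj ⟶ A.obj}
    (hx : A.IsRightLinear x) : A.IsRightLinear (A.leftAverage x) := by
  have h1 := hA.left
  have h2 := A.mul_assoc
  have hx : A.mul ≫ x = A.obj ◁ x ≫ A.mul := hx
  calc A.mul ≫ A.leftAverage x = (A.mul ≫ A.mul†) ≫ x ▷ A.obj ≫ A.mul := by simp [leftAverage]
    _ = A.obj ◁ A.mul† ≫ (α_ A.obj A.obj A.obj).inv ≫ (A.mul ≫ x) ▷ A.obj ≫ A.mul := by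
      rw [← h1]; simp
    _ = A.obj ◁ A.mul† ≫ (α_ A.obj A.obj A.obj).inv ≫ (A.obj ◁ x) ▷ A.obj ≫
        A.mul ▷ A.obj ≫ A.mul := by
      rw [hx]; simp
    _ = _ := by rw [h2]; simp [leftAverage]

lemma leftAverage_rightAverage (T : A.obj ⟶ A.obj) :
    A.leftAverage (A.rightAverage T) = A.rightAverage (A.leftAverage T) := by
  have h2 := A.mul_assoc
  have h3 : A.mul† ≫ A.mul† ▷ A.obj =
      A.mul† ≫ A.obj ◁ A.mul† ≫ (α_ A.obj A.obj A.obj).inv := by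
    simpa using congrArg CStarCategory.dagger h2
  calc A.leftAverage (A.rightAverage T) = (A.mul† ≫ A.mul† ▷ A.obj) ≫ (A.obj ◁ T) ▷ A.obj ≫
        A.mul ▷ A.obj ≫ A.mul := by simp [leftAverage, rightAverage]
    _ = A.rightAverage (A.leftAverage T) := by rw [h3, h2]; simp [leftAverage, rightAverage]

/-- The right linear endomorphisms are closed under the involution, being the range of
`rightAverage`. -/
lemma IsCStarFrobenius.dagger_right (hA : A.IsCStarFrobenius) (hs : A.IsSpecial)
    {x : A.obj ⟶ A.obj} (hx : A.IsRightLinear x) : A.IsRightLinear (x†) := by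
  rw [← hx.rightAverage_eq hs, dagger_rightAverage]
  exact hA.isRightLinear_rightAverage _

/-- A left linear `U` is the right multiplication by `U ι`. With `U'` the left multiplication by the
same element, `m (1_A ⊗ U') = m (U ⊗ 1_A)` by associativity. -/
lemma IsLeftLinear.leftAverage_leftMul {U : A.obj ⟶ A.obj} (hU : A.IsLeftLinear U) :
    A.leftAverage (A.leftMul (A.one ≫ U)) = A.rightAverage U := by
  have h2 := A.mul_assoc
  have hU : A.mul ≫ U = U ▷ A.obj ≫ A.mul := hU
  have h3 : (λ_ _).inv ≫ (A.one ≫ U) ▷ A.obj ≫ A.mul = U := by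
    rw [comp_whiskerRight, Category.assoc, ← hU, reassoc_of% A.mul_one]; simp
  have : A.leftMul (A.one ≫ U) ▷ A.obj ≫ A.mul = A.obj ◁ U ≫ A.mul := by
    conv_rhs => rw [← h3]
    calc _ = (ρ_ A.obj).inv ▷ A.obj ≫ (A.obj ◁ (A.one ≫ U)) ▷ A.obj ≫ A.mul ▷ A.obj ≫ A.mul := by
          simp [leftMul]
      _ = _ := by rw [h2]; simp
  rw [leftAverage, this, rightAverage]

lemma IsCStarFrobenius.isConjugateSolution (hA : A.IsCStarFrobenius) :
    IsConjugateSolution A.obj A.obj (A.one ≫ A.mul†) (A.one ≫ A.mul†) := by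
  have e1 : A.mul† ≫ A.obj ◁ A.one† = (ρ_ A.obj).inv := by
    simpa using congrArg CStarCategory.dagger A.one_mul
  have e2 : A.mul† ≫ A.one† ▷ A.obj = (λ_ A.obj).inv := by
    simpa using congrArg CStarCategory.dagger A.mul_one
  constructor
  · have h1 := hA.right
    calc _ = (λ_ A.obj).inv ≫ A.one ▷ A.obj ≫ (A.mul† ▷ A.obj ≫ (α_ _ _ _).hom ≫ A.obj ◁ A.mul) ≫
          A.obj ◁ A.one† ≫ (ρ_ A.obj).hom := by simp
      _ = _ := by
        rw [h1, Category.assoc, reassoc_of% A.mul_one, reassoc_of% e1]; simp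
  · have h1 := hA.left
    calc _ = (ρ_ A.obj).inv ≫ A.obj ◁ A.one ≫
          (A.obj ◁ A.mul† ≫ (α_ _ _ _).inv ≫ A.mul ▷ A.obj) ≫
          A.one† ▷ A.obj ≫ (λ_ A.obj).hom := by simp
      _ = _ := by
        rw [h1, Category.assoc, reassoc_of% A.one_mul, reassoc_of% e2]; simp

end Alg

/-! ### The actions of the center on 1-morphisms -/

section Center

variable {B : Type u} [Bicategory.{w, v} B]

/-- The action `1_Y ⊗ z` on `Y` of an endomorphism `z` of the horizontal unit at the source. -/
def sourceAct {M N : B} (Y : M ⟶ N) (z : 𝟙 M ⟶ 𝟙 M) : Y ⟶ Y :=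
  (λ_ Y).inv ≫ z ▷ Y ≫ (λ_ Y).hom

/-- The action `z ⊗ 1_Y` on `Y` of an endomorphism `z` of the horizontal unit at the target. -/
def targetAct {M N : B} (Y : M ⟶ N) (z : 𝟙 N ⟶ 𝟙 N) : Y ⟶ Y :=
  (ρ_ Y).inv ≫ Y ◁ z ≫ (ρ_ Y).hom

lemma sourceAct_naturality {M N : B} {Y Y' : M ⟶ N} (f : Y ⟶ Y') (z : 𝟙 M ⟶ 𝟙 M) :
    sourceAct Y z ≫ f = f ≫ sourceAct Y' z := by
  have := whisker_exchange z f
  simp only [sourceAct, Category.assoc, ← leftUnitor_naturality]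
  rw [reassoc_of% this.symm, leftUnitor_inv_naturality_assoc]

lemma sourceAct_naturality_assoc {M N : B} {Y Y' Y'' : M ⟶ N} (f : Y ⟶ Y') (z : 𝟙 M ⟶ 𝟙 M)
    (h : Y' ⟶ Y'') : sourceAct Y z ≫ f ≫ h = f ≫ sourceAct Y' z ≫ h := by
  rw [← Category.assoc, sourceAct_naturality, Category.assoc]

lemma targetAct_naturality {M N : B} {Y Y' : M ⟶ N} (f : Y ⟶ Y') (z : 𝟙 N ⟶ 𝟙 N) :
    targetAct Y z ≫ f = f ≫ targetAct Y' z := by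
  have := whisker_exchange f z
  simp only [targetAct, Category.assoc, ← rightUnitor_naturality]
  rw [reassoc_of% this, rightUnitor_inv_naturality_assoc]

lemma targetAct_naturality_assoc {M N : B} {Y Y' Y'' : M ⟶ N} (f : Y ⟶ Y') (z : 𝟙 N ⟶ 𝟙 N)
    (h : Y' ⟶ Y'') : targetAct Y z ≫ f ≫ h = f ≫ targetAct Y' z ≫ h := by
  rw [← Category.assoc, targetAct_naturality, Category.assoc]

@[simp] lemma sourceAct_id {M N : B} (Y : M ⟶ N) : sourceAct Y (𝟙 _) = 𝟙 Y := by simp [sourceAct]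

@[simp] lemma targetAct_id {M N : B} (Y : M ⟶ N) : targetAct Y (𝟙 _) = 𝟙 Y := by simp [targetAct]

lemma sourceAct_comp {M N : B} (Y : M ⟶ N) (z z' : 𝟙 M ⟶ 𝟙 M) :
    sourceAct Y (z ≫ z') = sourceAct Y z ≫ sourceAct Y z' := by simp [sourceAct]

lemma targetAct_comp {M N : B} (Y : M ⟶ N) (z z' : 𝟙 N ⟶ 𝟙 N) :
    targetAct Y (z ≫ z') = targetAct Y z ≫ targetAct Y z' := by simp [targetAct]

lemma sourceAct_unit {M : B} (z z' : 𝟙 M ⟶ 𝟙 M) :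
    z' ≫ sourceAct (𝟙 M) z = z ≫ z' := by
  rw [← sourceAct_naturality]
  congr 1
  rw [sourceAct, unitors_equal, rightUnitor_naturality, ← unitors_equal]
  simp

/-- The Eckmann-Hilton argument: the center `End(1_M)` is commutative. -/
lemma unit_comp_comm {M : B} (z z' : 𝟙 M ⟶ 𝟙 M) : z ≫ z' = z' ≫ z := by
  rw [← sourceAct_unit, sourceAct, unitors_equal, rightUnitor_naturality, ← unitors_equal]
  simp

lemma comp_sourceAct {M : B} {Y : M ⟶ M} (x : 𝟙 M ⟶ Y) (z : 𝟙 M ⟶ 𝟙 M) :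
    x ≫ sourceAct Y z = z ≫ x := by
  rw [← sourceAct_naturality, sourceAct, unitors_equal, rightUnitor_naturality, ← unitors_equal]
  simp

lemma comp_targetAct {M : B} {Y : M ⟶ M} (x : 𝟙 M ⟶ Y) (z : 𝟙 M ⟶ 𝟙 M) :
    x ≫ targetAct Y z = z ≫ x := by
  rw [← targetAct_naturality, targetAct, ← unitors_equal, leftUnitor_naturality]
  simp [unitors_equal]

lemma targetAct_whiskerRight {L M N : B} (Y : L ⟶ M) (Y' : M ⟶ N) (z : 𝟙 M ⟶ 𝟙 M) :
    targetAct Y z ▷ Y' = Y ◁ sourceAct Y' z := by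
  simp [targetAct, sourceAct]

variable {M : B} (A : Alg M)

lemma isLeftLinear_sourceAct (z : 𝟙 M ⟶ 𝟙 M) : A.IsLeftLinear (sourceAct A.obj z) := by
  rw [Alg.IsLeftLinear, ← sourceAct_naturality]
  simp [sourceAct]

lemma isRightLinear_targetAct (z : 𝟙 M ⟶ 𝟙 M) : A.IsRightLinear (targetAct A.obj z) := by
  rw [Alg.IsRightLinear, ← targetAct_naturality]
  simp [targetAct]

variable {A} in
/-- If the action of `z` from one side is the action of some `z'` from the other side, then `z'` can
be replaced by `z`: right linear maps are determined by their value on the unit `ι`, on which both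
sides act alike. -/
lemma sourceAct_eq_targetAct_of_eq {z z' : 𝟙 M ⟶ 𝟙 M}
    (h : sourceAct A.obj z = targetAct A.obj z') : sourceAct A.obj z = targetAct A.obj z := by
  refine Alg.IsRightLinear.eq_of_one (h ▸ isRightLinear_targetAct A z')
    (isRightLinear_targetAct A z) ?_
  rw [comp_sourceAct, comp_targetAct]

variable [CStarBicategory B]

lemma dagger_sourceAct {M N : B} (Y : M ⟶ N) (z : 𝟙 M ⟶ 𝟙 M) :
    (sourceAct Y z)† = sourceAct Y (z†) := by simp [sourceAct]

lemma dagger_targetAct {M N : B} (Y : M ⟶ N) (z : 𝟙 N ⟶ 𝟙 N) :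
    (targetAct Y z)† = targetAct Y (z†) := by simp [targetAct]

open CStarCategory CStarBicategory in
lemma sourceAct_add {M N : B} (Y : M ⟶ N) (z z' : 𝟙 M ⟶ 𝟙 M) :
    sourceAct Y (z + z') = sourceAct Y z + sourceAct Y z' := by
  simp only [sourceAct, add_whiskerRight, add_comp, comp_add]

open CStarCategory CStarBicategory in
lemma targetAct_add {M N : B} (Y : M ⟶ N) (z z' : 𝟙 N ⟶ 𝟙 N) :
    targetAct Y (z + z') = targetAct Y z + targetAct Y z' := by
  simp only [targetAct, whiskerLeft_add, add_comp, comp_add]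

open CStarCategory CStarBicategory in
lemma sourceAct_smul {M N : B} (Y : M ⟶ N) (c : ℂ) (z : 𝟙 M ⟶ 𝟙 M) :
    sourceAct Y (c • z) = c • sourceAct Y z := by
  simp only [sourceAct, smul_whiskerRight, smul_comp, comp_smul]

open CStarCategory CStarBicategory in
lemma targetAct_smul {M N : B} (Y : M ⟶ N) (c : ℂ) (z : 𝟙 N ⟶ 𝟙 N) :
    targetAct Y (c • z) = c • targetAct Y z := by
  simp only [targetAct, whiskerLeft_smul, smul_comp, comp_smul]

end Center

/-! ### Transported algebras -/

namespace Alg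

section Linear

variable {B : Type u} [Bicategory.{w, v} B] {M : B} {A : Alg M}
  {t v : A.obj ⟶ A.obj} {ht : A.IsRightLinear t} {hv : A.IsRightLinear v}
  {hvt : v ≫ t = 𝟙 _} {htv : t ≫ v = 𝟙 _}

lemma isHom_transport :
    IsHom A (A.transport t v ht hv hvt htv) t where
  mul := by
    change A.mul ≫ t = hTensor t t ≫ v ▷ A.obj ≫ A.mul
    have ht : A.mul ≫ t = A.obj ◁ t ≫ A.mul := ht
    rw [ht, hTensor, Category.assoc, whisker_exchange_assoc, ← comp_whiskerRight_assoc, htv]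
    simp
  one := rfl

lemma isRightLinear_transport_iff {x : A.obj ⟶ A.obj} :
    (A.transport t v ht hv hvt htv).IsRightLinear x ↔ A.IsRightLinear x := by
  change (v ▷ A.obj ≫ A.mul) ≫ x = A.obj ◁ x ≫ v ▷ A.obj ≫ A.mul ↔ A.mul ≫ x = A.obj ◁ x ≫ A.mul
  rw [whisker_exchange_assoc, Category.assoc]
  have : IsIso (v ▷ A.obj) := ⟨t ▷ A.obj, by simp [← comp_whiskerRight, hvt, htv]⟩
  exact cancel_epi _

end Linear

variable {B : Type u} [Bicategory.{w, v} B] [CStarBicategory B] {M : B} {A : Alg M}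
  {t v : A.obj ⟶ A.obj} {ht : A.IsRightLinear t} {hv : A.IsRightLinear v}
  {hvt : v ≫ t = 𝟙 _} {htv : t ≫ v = 𝟙 _}

lemma IsCStarFrobenius.transport (hA : A.IsCStarFrobenius) (hs : A.IsSpecial) :
    (A.transport t v ht hv hvt htv).IsCStarFrobenius where
  left := by
    have hv' : A.mul ≫ v† = A.obj ◁ v† ≫ A.mul := hA.dagger_right hs hv
    change A.obj ◁ (v ▷ A.obj ≫ A.mul)† ≫ (α_ A.obj A.obj A.obj).inv ≫
      (v ▷ A.obj ≫ A.mul) ▷ A.obj = (v ▷ A.obj ≫ A.mul) ≫ (v ▷ A.obj ≫ A.mul)†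
    symm
    calc _ = v ▷ A.obj ≫ (A.mul ≫ A.mul†) ≫ v† ▷ A.obj := by simp
      _ = (v ▷ A.obj ≫ A.obj ◁ A.mul†) ≫ (α_ A.obj A.obj A.obj).inv ≫ (A.mul ≫ v†) ▷ A.obj := by
        rw [← hA.left]; simp
      _ = A.obj ◁ A.mul† ≫ (v ▷ (A.obj ≫ A.obj) ≫ A.obj ◁ v† ▷ A.obj) ≫
          (α_ A.obj A.obj A.obj).inv ≫ A.mul ▷ A.obj := by
        rw [hv', ← whisker_exchange]; simp
      _ = _ := by
        rw [← whisker_exchange]; simp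
  right := by
    have hv' : v ≫ A.mul† = A.mul† ≫ A.obj ◁ v := by
      have : A.mul ≫ v† = A.obj ◁ v† ≫ A.mul := hA.dagger_right hs hv
      simpa using congrArg CStarCategory.dagger this
    change (v ▷ A.obj ≫ A.mul)† ▷ A.obj ≫ (α_ A.obj A.obj A.obj).hom ≫
      A.obj ◁ (v ▷ A.obj ≫ A.mul) = (v ▷ A.obj ≫ A.mul) ≫ (v ▷ A.obj ≫ A.mul)†
    symm
    calc _ = v ▷ A.obj ≫ (A.mul ≫ A.mul†) ≫ v† ▷ A.obj := by simp
      _ = (v ≫ A.mul†) ▷ A.obj ≫ (α_ A.obj A.obj A.obj).hom ≫ A.obj ◁ A.mul ≫ v† ▷ A.obj := by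
        rw [← hA.right]; simp
      _ = A.mul† ▷ A.obj ≫ (α_ A.obj A.obj A.obj).hom ≫
          (A.obj ◁ v ▷ A.obj ≫ v† ▷ (A.obj ≫ A.obj)) ≫ A.obj ◁ A.mul := by
        rw [hv', whisker_exchange]; simp
      _ = _ := by
        rw [whisker_exchange]; simp

lemma isSpecial_transport (h : A.leftAverage (v† ≫ v) = 𝟙 _) :
    (A.transport t v ht hv hvt htv).IsSpecial := by
  change (v ▷ A.obj ≫ A.mul)† ≫ v ▷ A.obj ≫ A.mul = 𝟙 A.obj
  simpa [leftAverage] using h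

/-- The solution of the conjugate equations defined by the transported algebra is the twist by `t`
of the original one. -/
lemma one_mul_dagger_transport (hA : A.IsCStarFrobenius) (hs : A.IsSpecial) :
    (A.transport t v ht hv hvt htv).one ≫ (A.transport t v ht hv hvt htv).mul† =
      A.twisted ⟨t, v, htv, hvt⟩ := by
  change (A.one ≫ t) ≫ (v ▷ A.obj ≫ A.mul)† = A.one ≫ A.mul† ≫ hTensor t (v†)
  have ht' : t ≫ A.mul† = A.mul† ≫ A.obj ◁ t := by
    have : A.mul ≫ t† = A.obj ◁ t† ≫ A.mul := hA.dagger_right hs ht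
    simpa using congrArg CStarCategory.dagger this
  simp [hTensor, reassoc_of% ht', whisker_exchange]

lemma leftAverage_transport (x : A.obj ⟶ A.obj) :
    (A.transport t v ht hv hvt htv).leftAverage x = A.leftAverage (v† ≫ x ≫ v) := by
  change (v ▷ A.obj ≫ A.mul)† ≫ x ▷ A.obj ≫ v ▷ A.obj ≫ A.mul = _
  simp [leftAverage]

end Alg

/-! ### Endomorphism C*-algebras -/

section CEnd

variable {C : Type v} [Category.{w} C] [CStarCategory C]

lemma norm_dagger {X Y : C} (f : X ⟶ Y) : ‖f†‖ = ‖f‖ := by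
  have key : ∀ {X Y : C} (f : X ⟶ Y), ‖f‖ ≤ ‖f†‖ := by
    intro X Y f
    by_cases h : ‖f‖ = 0
    · rw [h]; exact norm_nonneg _
    · have h1 := CStarCategory.norm_comp_dagger f
      have h2 := CStarCategory.norm_comp_le f (f†)
      rw [h1, sq] at h2
      exact le_of_mul_le_mul_left h2 (lt_of_le_of_ne (norm_nonneg _) (Ne.symm h))
  exact le_antisymm (by simpa using key (f†)) (key f)

lemma norm_id_le (X : C) : ‖𝟙 X‖ ≤ 1 := by
  have h := CStarCategory.norm_comp_dagger (𝟙 X)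
  rw [dagger_id, Category.id_comp] at h
  nlinarith [norm_nonneg (𝟙 X)]

/-- The endomorphisms of an object of a C*-category, as a C*-algebra. The product is composition in
diagrammatic order, `x * y = x ≫ y`, so this is the opposite of the usual endomorphism algebra. -/
abbrev CEnd (X : C) : Type w := X ⟶ X

noncomputable instance (X : C) : NormedRing (CEnd X) where
  __ := (CStarCategory.homNormed X X : NormedAddCommGroup (X ⟶ X))
  mul x y := (x ≫ y : X ⟶ X)
  one := 𝟙 X
  left_distrib x y z := CStarCategory.comp_add (C := C) x y z
  right_distrib x y z := CStarCategory.add_comp (C := C) x y z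
  zero_mul x := Limits.zero_comp (C := C) (f := x)
  mul_zero x := Limits.comp_zero (C := C) (f := x)
  mul_assoc x y z := Category.assoc (obj := C) x y z
  one_mul x := Category.id_comp (obj := C) x
  mul_one x := Category.comp_id (obj := C) x
  norm_mul_le x y := CStarCategory.norm_comp_le (C := C) x y
  dist_eq := (CStarCategory.homNormed X X).dist_eq

noncomputable instance (X : C) : NormedSpace ℂ (CEnd X) where
  __ := (CStarCategory.homSpace X X).toModule
  norm_smul_le := (CStarCategory.homSpace X X).norm_smul_le

noncomputable instance (X : C) : NormedAlgebra ℂ (CEnd X) where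
  __ := Algebra.ofModule (R := ℂ) (A := CEnd X)
    (fun c x y => CStarCategory.smul_comp (C := C) c x y)
    (fun c x y => CStarCategory.comp_smul (C := C) x c y)
  norm_smul_le := (CStarCategory.homSpace X X).norm_smul_le

noncomputable instance (X : C) : CStarAlgebra (CEnd X) where
  star x := CStarCategory.dagger (C := C) x
  star_involutive x := CStarCategory.dagger_dagger (C := C) x
  star_mul x y := CStarCategory.dagger_comp (C := C) x y
  star_add x y := CStarCategory.dagger_add (C := C) x y
  complete := (CStarCategory.homComplete X X).complete
  norm_mul_self_le x := by
    have h1 := CStarCategory.norm_comp_dagger (C := C) (show X ⟶ X from x)†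
    rw [CStarCategory.dagger_dagger, norm_dagger, sq] at h1
    exact h1.ge
  star_smul c x := CStarCategory.dagger_smul (C := C) c x

end CEnd

/-! ### Finite-dimensional commutative C*-algebras, Gordan's alternative, square roots -/

section FiniteDimensional

/-- Distinct characters are linearly independent. -/
lemma finite_characterSpace (Z : Type*) [CommCStarAlgebra Z] [FiniteDimensional ℂ Z] :
    Finite (WeakDual.characterSpace ℂ Z) := by
  let f : WeakDual.characterSpace ℂ Z → (Z →* ℂ) := fun χ =>
    ((WeakDual.CharacterSpace.toAlgHom χ : Z →ₐ[ℂ] ℂ) : Z →* ℂ)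
  have hf : Function.Injective f := by
    intro χ χ' h
    ext z
    exact DFunLike.congr_fun h z
  have h1 := (linearIndependent_monoidHom Z ℂ).comp f hf
  let g : WeakDual.characterSpace ℂ Z → Module.Dual ℂ Z := fun χ =>
    (WeakDual.CharacterSpace.toAlgHom χ).toLinearMap
  have h2 : LinearIndependent ℂ g :=
    LinearIndependent.of_comp
      ({ toFun := fun l => l, map_add' := fun _ _ => rfl, map_smul' := fun _ _ => rfl } :
        Module.Dual ℂ Z →ₗ[ℂ] (Z → ℂ)) h1
  exact h2.finite

/-- A finite-dimensional commutative C*-algebra has minimal projections `e a` dual to its characters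
`χ a`; the characters separate points and compute the norm. -/
lemma exists_minimal_projections (Z : Type*) [CommCStarAlgebra Z] [FiniteDimensional ℂ Z] :
    ∃ (n : ℕ) (e : Fin n → Z) (χ : Fin n → Z →⋆ₐ[ℂ] ℂ),
      (∀ a b, χ a (e b) = if a = b then 1 else 0) ∧
      (∀ x y, (∀ a, χ a x = χ a y) → x = y) ∧
      (∀ x (r : ℝ), 0 ≤ r → (∀ a, ‖χ a x‖ ≤ r) → ‖x‖ ≤ r) := by
  classical
  have := finite_characterSpace Z
  obtain ⟨n, ⟨σ⟩⟩ := Finite.exists_equiv_fin (WeakDual.characterSpace ℂ Z)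
  let G := gelfandStarTransform Z
  let ev : WeakDual.characterSpace ℂ Z → (C(WeakDual.characterSpace ℂ Z, ℂ) →⋆ₐ[ℂ] ℂ) := fun χ =>
    ContinuousMap.evalStarAlgHom ℂ ℂ χ
  let e : Fin n → Z := fun a => G.symm ⟨fun χ => if σ χ = a then 1 else 0, by fun_prop⟩
  have hn : ∀ z, ‖G z‖ = ‖z‖ := fun z =>
    (gelfandTransform_isometry Z).norm_map_of_map_zero (map_zero _) z
  refine ⟨n, e, fun a => (ev (σ.symm a)).comp (G : Z →⋆ₐ[ℂ] _), ?_, ?_, ?_⟩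
  · intro a b
    simp [e, ev]
  · intro x y h
    have : G x = G y := ContinuousMap.ext fun χ => by simpa [ev] using h (σ χ)
    exact EquivLike.injective G this
  · intro x r hr h
    rw [← hn, ContinuousMap.norm_le _ hr]
    intro χ
    simpa [ev] using h (σ χ)

/-- Gordan's alternative: finitely many linear functionals that are never simultaneously positive
have a vanishing convex combination. -/
lemma gordan {D W : Type*} [Fintype D] [AddCommGroup W] [Module ℝ W]
    (l : D → W →ₗ[ℝ] ℝ) (h : ∀ s, ∃ a, l a s ≤ 0) :
    ∃ c : D → ℝ, (∀ a, 0 ≤ c a) ∧ ∑ a, c a = 1 ∧ ∀ s, ∑ a, c a * l a s = 0 := by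
  classical
  let P : Set (D → ℝ) := {x | ∀ a, 0 < x a}
  let L : W →ₗ[ℝ] (D → ℝ) := LinearMap.pi l
  have hP : Convex ℝ P := by
    intro x hx y hy a b ha hb hab i
    have := hx i
    have := hy i
    simp only [Pi.add_apply, Pi.smul_apply, smul_eq_mul]
    rcases ha.lt_or_eq with ha | rfl
    · have := mul_pos ha (hx i)
      have := mul_nonneg hb (hy i).le
      linarith
    · simp at hab; subst hab; simpa using hy i
  have hPo : IsOpen P := by
    have : P = ⋂ a, {x | 0 < x a} := by ext; simp [P]
    rw [this]
    exact isOpen_iInter_of_finite fun a => isOpen_lt continuous_const (continuous_apply a)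
  obtain ⟨f, r, hf1, hf2⟩ := geometric_hahn_banach_open hP hPo
    (LinearMap.range L).convex (by
      rw [Set.disjoint_left]
      rintro _ hx ⟨s, rfl⟩
      obtain ⟨a, ha⟩ := h s
      exact absurd (hx a) (not_lt.mpr ha))
  have hr : r ≤ 0 := by simpa using hf2 0 (zero_mem _)
  -- a linear functional bounded below on a subspace vanishes there
  have h0 : ∀ s, f (L s) = 0 := by
    intro s
    by_contra hne
    have := hf2 (L (((r - 1) / f (L s)) • s)) ⟨_, rfl⟩
    rw [map_smul, map_smul, smul_eq_mul, div_mul_cancel₀ _ hne] at this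
    linarith
  have hsum : ∀ x : D → ℝ, f x = ∑ a, x a * f (Pi.single a 1) := by
    intro x
    conv_lhs => rw [← Finset.univ_sum_single x]
    rw [map_sum]
    refine Finset.sum_congr rfl fun a _ => ?_
    have : Pi.single a (x a) = x a • (Pi.single a 1 : D → ℝ) := by
      rw [← Pi.single_smul]; simp
    rw [this, map_smul, smul_eq_mul]
  have hneg : ∀ a, f (Pi.single a 1) ≤ 0 := by
    intro a
    have hc : ∀ δ : ℝ, 0 < δ → f (Pi.single a 1) + δ * f 1 ≤ 0 := by
      intro δ hδ
      have hmem : (Pi.single a 1 + δ • (1 : D → ℝ)) ∈ P := by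
        intro b
        by_cases hb : b = a
        · subst hb; simp; linarith
        · simp [hb, hδ]
      have := hf1 _ hmem
      rw [map_add, map_smul, smul_eq_mul] at this
      linarith
    have ht : Filter.Tendsto (fun δ : ℝ => f (Pi.single a 1) + δ * f 1) (nhdsWithin 0 (Set.Ioi 0))
        (nhds (f (Pi.single a 1) + 0 * f 1)) :=
      ((continuous_const.add (continuous_id.mul continuous_const)).tendsto 0).mono_left
        nhdsWithin_le_nhds
    have := le_of_tendsto ht (Filter.eventually_of_mem self_mem_nhdsWithin hc)
    simpa using this
  have hone : f 1 < 0 := lt_of_lt_of_le (hf1 1 fun _ => one_pos) hr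
  refine ⟨fun a => f (Pi.single a 1) / f 1, fun a => div_nonneg_of_nonpos (hneg a) hone.le, ?_, ?_⟩
  · rw [← Finset.sum_div, div_eq_one_iff_eq hone.ne, hsum 1]
    simp
  · intro s
    have : ∑ a, f (Pi.single a 1) / f 1 * l a s = f (L s) / f 1 := by
      rw [hsum (L s), Finset.sum_div]
      refine Finset.sum_congr rfl fun a _ => ?_
      simp [L]; ring
    rw [this, h0, zero_div]

/-- `1 + s` has an invertible selfadjoint square root if `s` is selfadjoint with `‖s‖ < 1`. -/
lemma exists_selfAdjoint_sqrt {E : Type*} [CStarAlgebra E] {s : E} (hs : star s = s)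
    (h : ‖s‖ < 1) : ∃ v : E, star v = v ∧ v * v = 1 + s ∧ IsUnit v := by
  let _ := CStarAlgebra.spectralOrder E
  have := CStarAlgebra.spectralOrderedRing E
  have h1 : 0 ≤ 1 + s := by
    have h2 := IsSelfAdjoint.neg_algebraMap_norm_le_self (a := s) hs
    have h3 : algebraMap ℝ E ‖s‖ ≤ algebraMap ℝ E 1 := algebraMap_mono E h.le
    rw [map_one] at h3
    have : -(1 : E) ≤ s := (neg_le_neg h3).trans h2
    simpa using add_le_add_right this 1
  have hv := CFC.sqrt_mul_sqrt_self (1 + s) h1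
  refine ⟨CFC.sqrt (1 + s), (CFC.sqrt_nonneg _).isSelfAdjoint, hv, ?_⟩
  have hu : IsUnit (1 + s) := by
    have := (Units.oneSub (-s) (by simpa using h)).isUnit
    simpa using this
  rw [← hv] at hu
  exact ((Commute.refl _).isUnit_mul_iff.mp hu).1

end FiniteDimensional

/-! ### Norms of whiskered 2-morphisms, characters and transposes -/

section Whisker

variable {B : Type u} [Bicategory.{w, v} B] [CStarBicategory B]

noncomputable instance (M : B) : CommCStarAlgebra (CEnd (𝟙 M)) where
  mul_comm x y := unit_comp_comm x y

open CStarBicategory in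
/-- Whiskering restricts to star homomorphisms of endomorphism algebras, which are contractive. -/
lemma norm_whiskerRight_le {a b c : B} {f g : a ⟶ b} (η : f ⟶ g) (h : b ⟶ c) :
    ‖η ▷ h‖ ≤ ‖η‖ := by
  let φ : CEnd f →⋆ₐ[ℂ] CEnd (f ≫ h) :=
    { toFun := fun x => x ▷ h
      map_one' := id_whiskerRight f h
      map_mul' := fun x y => comp_whiskerRight x y h
      map_zero' := by
        have := smul_whiskerRight (0 : ℂ) (0 : f ⟶ f) h
        simpa using this
      map_add' := fun x y => add_whiskerRight x y h
      commutes' := fun c => by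
        have := smul_whiskerRight c (𝟙 f) h
        rw [id_whiskerRight] at this
        exact this
      map_star' := fun x => (dagger_whiskerRight x h).symm }
  have h1 : ‖(η ≫ η†) ▷ h‖ ≤ ‖η ≫ η†‖ := NonUnitalStarAlgHom.norm_apply_le φ (η ≫ η†)
  rw [comp_whiskerRight, ← dagger_whiskerRight, CStarCategory.norm_comp_dagger,
    CStarCategory.norm_comp_dagger] at h1
  exact le_of_sq_le_sq h1 (norm_nonneg _)

open CStarBicategory in
lemma norm_whiskerLeft_le {a b c : B} (h : a ⟶ b) {f g : b ⟶ c} (η : f ⟶ g) :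
    ‖h ◁ η‖ ≤ ‖η‖ := by
  let φ : CEnd f →⋆ₐ[ℂ] CEnd (h ≫ f) :=
    { toFun := fun x => h ◁ x
      map_one' := whiskerLeft_id h f
      map_mul' := fun x y => whiskerLeft_comp h x y
      map_zero' := by
        have := whiskerLeft_smul h (0 : ℂ) (0 : f ⟶ f)
        simpa using this
      map_add' := fun x y => whiskerLeft_add h x y
      commutes' := fun c => by
        have := whiskerLeft_smul h c (𝟙 f)
        rw [whiskerLeft_id] at this
        exact this
      map_star' := fun x => (dagger_whiskerLeft h x).symm }
  have h1 : ‖h ◁ (η ≫ η†)‖ ≤ ‖η ≫ η†‖ := NonUnitalStarAlgHom.norm_apply_le φ (η ≫ η†)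
  rw [whiskerLeft_comp, ← dagger_whiskerLeft, CStarCategory.norm_comp_dagger,
    CStarCategory.norm_comp_dagger] at h1
  exact le_of_sq_le_sq h1 (norm_nonneg _)

end Whisker

section Character

variable {C : Type v} [Category.{w} C] [CStarCategory C]

/-- Characters are positive on `y y*`, because `y y* = g g*` for an endomorphism `g`. -/
lemma exists_nonneg_eq {X Y : C} (χ : CEnd X →⋆ₐ[ℂ] ℂ) (y : X ⟶ Y) :
    ∃ r : ℝ, 0 ≤ r ∧ χ (y ≫ y†) = r := by
  obtain ⟨g, hg⟩ := CStarCategory.comp_dagger_nonneg y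
  refine ⟨Complex.normSq (χ g), Complex.normSq_nonneg _, ?_⟩
  have : χ (g ≫ g†) = χ g * star (χ g) := by
    rw [← map_star, ← map_mul]; rfl
  rw [hg, this, ← Complex.mul_conj]; rfl

end Character

section Finite

variable {B : Type u} [Bicategory.{w, v} B] [CStarBicategory B] {M : B} {X Xd : M ⟶ M}
  {ω : 𝟙 M ⟶ X ≫ Xd} {ω' : 𝟙 M ⟶ Xd ≫ X}

/-- `x*` is recovered from its transpose `(1_X̄ ⊗ x*) ω : 1 ⟶ X̄`. -/
lemma IsConjugateSolution.dagger_eq (h : IsConjugateSolution X Xd ω ω') (x : 𝟙 M ⟶ X) :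
    x† = (λ_ X).inv ≫ (ω ≫ x† ▷ Xd ≫ (λ_ Xd).hom) ▷ X ≫ ω'† := by
  symm
  calc _ = (λ_ X).inv ≫ ω ▷ X ≫ (α_ _ _ _).hom ≫ (x† ▷ (Xd ≫ X) ≫ 𝟙 M ◁ ω'†) ≫ (λ_ _).hom := by
        simp
    _ = ((λ_ X).inv ≫ ω ▷ X ≫ (α_ _ _ _).hom ≫ X ◁ ω'† ≫ (ρ_ X).hom) ≫ x† := by
        rw [← whisker_exchange]; simp [unitors_equal]
    _ = _ := by rw [h.left, Category.id_comp]

end Finite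

/-! ### Finite-dimensionality of hom spaces -/

section Finite

variable {B : Type u} [Bicategory.{w, v} B] [CStarBicategory B] {M : B} {X Xd : M ⟶ M}
  {ω : 𝟙 M ⟶ X ≫ Xd} {ω' : 𝟙 M ⟶ Xd ≫ X}

/-- Families of partial isometries `1 ⟶ X` with orthogonal ranges have bounded length: the range
projections sum up to at most `1_X`, so the squared lengths of the transposes sum up to at most that
of `ω`, while each of them is bounded below because `x` is recovered from its transpose. -/
lemma IsConjugateSolution.exists_card_le (hfin : FiniteDimensional ℂ (𝟙 M ⟶ 𝟙 M))
    (h : IsConjugateSolution X Xd ω ω') :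
    ∃ N : ℕ, ∀ (k : ℕ) (x : Fin k → (𝟙 M ⟶ X)), (∀ i j, i ≠ j → x i ≫ (x j)† = 0) →
      (∀ i, x i ≫ (x i)† ≫ x i = x i) → (∀ i, 1 ≤ ‖x i‖) → k ≤ N := by
  have : FiniteDimensional ℂ (CEnd (𝟙 M)) := hfin
  obtain ⟨n, e, χ, he, hinj, hnorm⟩ := exists_minimal_projections (CEnd (𝟙 M))
  let τ : CEnd (𝟙 M) →ₗ[ℝ] ℝ :=
    ∑ b, Complex.reLm ∘ₗ ((χ b).toAlgHom.toLinearMap.restrictScalars ℝ)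
  have hτ : ∀ z, τ z = ∑ b, (χ b z).re := fun z => by simp [τ]
  have hτpos : ∀ {Y : M ⟶ M} (y : 𝟙 M ⟶ Y), ‖y‖ ^ 2 ≤ τ (y ≫ y†) := by
    intro Y y
    have hb : ∀ b, 0 ≤ (χ b (y ≫ y†)).re ∧ ‖χ b (y ≫ y†)‖ = (χ b (y ≫ y†)).re := by
      intro b
      obtain ⟨r, hr, hr'⟩ := exists_nonneg_eq (χ b) y
      rw [hr']
      simp [abs_of_nonneg hr, hr]
    rw [← CStarCategory.norm_comp_dagger, hτ]
    refine hnorm _ _ (Finset.sum_nonneg fun b _ => (hb b).1) fun b => ?_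
    rw [(hb b).2]
    exact Finset.single_le_sum (f := fun b => (χ b (y ≫ y†)).re) (fun b _ => (hb b).1)
      (Finset.mem_univ b)
  -- the transpose of `x` has norm at least `‖x‖ / D`
  let D : ℝ := ‖(λ_ X).inv‖ * ‖ω'†‖
  obtain ⟨N, hN⟩ := exists_nat_ge (τ (ω ≫ ω†) * D ^ 2)
  refine ⟨N, fun k x hx1 hx2 hx3 => ?_⟩
  let y : Fin k → (𝟙 M ⟶ Xd) := fun i => ω ≫ (x i)† ▷ Xd ≫ (λ_ Xd).hom
  have hy : ∀ i, 1 ≤ D ^ 2 * τ (y i ≫ (y i)†) := by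
    intro i
    have h1 : ‖x i‖ ≤ D * ‖y i‖ := by
      rw [← norm_dagger, h.dagger_eq (x i)]
      calc _ ≤ ‖(λ_ X).inv‖ * (‖y i ▷ X‖ * ‖ω'†‖) :=
            (CStarCategory.norm_comp_le _ _).trans
              (mul_le_mul_of_nonneg_left (CStarCategory.norm_comp_le _ _) (norm_nonneg _))
        _ ≤ ‖(λ_ X).inv‖ * (‖y i‖ * ‖ω'†‖) := by
            gcongr; exact norm_whiskerRight_le _ _
        _ = _ := by ring
    have h2 : (1 : ℝ) ≤ (D * ‖y i‖) ^ 2 := by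
      have := (hx3 i).trans h1
      nlinarith
    calc (1 : ℝ) ≤ D ^ 2 * ‖y i‖ ^ 2 := by rw [← mul_pow]; exact h2
      _ ≤ _ := by gcongr; exact hτpos _
  let P : X ⟶ X := ∑ i, (x i)† ≫ x i
  have hPx : ∀ i, x i ≫ P = x i := by
    intro i
    rw [Preadditive.comp_sum, Finset.sum_eq_single i]
    · exact hx2 i
    · intro j _ hj
      rw [← Category.assoc, hx1 i j hj.symm, Limits.zero_comp]
    · simp
  have hPP : P ≫ P = P := by
    conv_lhs => enter [1]; simp only [P]
    rw [Preadditive.sum_comp]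
    simp only [Category.assoc, hPx, P]
  have hPd : P† = P := by
    change star (P : CEnd X) = P
    have : ∀ i, star (((x i)† ≫ x i : X ⟶ X) : CEnd X) = ((x i)† ≫ x i : X ⟶ X) := fun i => by
      change ((x i)† ≫ x i)† = _
      simp
    simp only [P]
    rw [star_sum]
    exact Finset.sum_congr rfl fun i _ => this i
  let Q : X ⟶ X := 𝟙 X - P
  have hQQ : Q ≫ Q† = Q := by
    have : Q† = Q := by
      change star (1 - (P : CEnd X)) = 1 - P
      rw [star_sub, star_one]; congr 1
    rw [this]
    simp only [Q, Preadditive.sub_comp, Preadditive.comp_sub, hPP]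
    simp
  have hsplit : ω ≫ ω† = (ω ≫ Q ▷ Xd) ≫ (ω ≫ Q ▷ Xd)† + ∑ i, y i ≫ (y i)† := by
    have h1 : (ω ≫ Q ▷ Xd) ≫ (ω ≫ Q ▷ Xd)† = ω ≫ (Q ≫ Q†) ▷ Xd ≫ ω† := by simp
    have h2 : ∀ i, y i ≫ (y i)† = ω ≫ ((x i)† ≫ x i) ▷ Xd ≫ ω† := by intro i; simp [y]
    have h3 : ∀ T T' : X ⟶ X, (T + T') ▷ Xd = T ▷ Xd + T' ▷ Xd := fun T T' =>
      CStarBicategory.add_whiskerRight _ _ _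
    let F : (X ⟶ X) →+ (𝟙 M ⟶ 𝟙 M) :=
      { toFun := fun T => ω ≫ T ▷ Xd ≫ ω†
        map_zero' := by
          have := CStarBicategory.smul_whiskerRight (0 : ℂ) (0 : X ⟶ X) Xd
          simp only [zero_smul] at this
          simp [this]
        map_add' := fun T T' => by simp [h3] }
    have h4 : F (𝟙 X) = F (Q + P) := by simp [Q]
    rw [h1, hQQ, Finset.sum_congr rfl fun i _ => h2 i]
    change _ = F Q + ∑ i, F ((x i)† ≫ x i)
    rw [← map_sum, ← map_add, ← h4]
    simp [F]
  have h5 : ∑ i, τ (y i ≫ (y i)†) ≤ τ (ω ≫ ω†) := by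
    rw [hsplit, map_add, map_sum]
    linarith [(sq_nonneg ‖ω ≫ Q ▷ Xd‖).trans (hτpos (ω ≫ Q ▷ Xd))]
  have h6 : (k : ℝ) ≤ N := by
    calc (k : ℝ) = ∑ i : Fin k, (1 : ℝ) := by simp
      _ ≤ ∑ i : Fin k, D ^ 2 * τ (y i ≫ (y i)†) := Finset.sum_le_sum fun i _ => hy i
      _ = D ^ 2 * ∑ i : Fin k, τ (y i ≫ (y i)†) := by rw [Finset.mul_sum]
      _ ≤ D ^ 2 * τ (ω ≫ ω†) := by gcongr
      _ ≤ N := by linarith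
  exact_mod_cast h6

/-- If `X` has a dual, then `Hom(1_M, X)` is finite-dimensional. It is spanned over the
finite-dimensional algebra `End(1_M)` by a maximal orthonormal family, which is finite. -/
lemma IsConjugateSolution.finiteDimensional (hfin : FiniteDimensional ℂ (𝟙 M ⟶ 𝟙 M))
    (h : IsConjugateSolution X Xd ω ω') : FiniteDimensional ℂ (𝟙 M ⟶ X) := by
  obtain ⟨N, hN⟩ := h.exists_card_le hfin
  have : FiniteDimensional ℂ (CEnd (𝟙 M)) := hfin
  obtain ⟨n, e, χ, he, hinj, hnorm⟩ := exists_minimal_projections (CEnd (𝟙 M))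
  by_contra hinf
  -- otherwise orthonormal families of every length exist
  have key : ∀ k : ℕ, ∃ x : Fin k → (𝟙 M ⟶ X), (∀ i j, i ≠ j → x i ≫ (x j)† = 0) ∧
      (∀ i, x i ≫ (x i)† ≫ x i = x i) ∧ (∀ i, 1 ≤ ‖x i‖) := by
    intro k
    induction k with
    | zero => exact ⟨Fin.elim0, fun i => i.elim0, fun i => i.elim0, fun i => i.elim0⟩
    | succ k ih =>
      obtain ⟨x, hx1, hx2, hx3⟩ := ih
      let L : (Fin k → (𝟙 M ⟶ 𝟙 M)) →ₗ[ℂ] (𝟙 M ⟶ X) :=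
        { toFun := fun c => ∑ i, c i ≫ x i
          map_add' := fun c d => by simp [Finset.sum_add_distrib]
          map_smul' := fun r c => by simp [Finset.smul_sum] }
      have hL : LinearMap.range L ≠ ⊤ := by
        intro hL
        exact hinf (Module.Finite.of_surjective L (LinearMap.range_eq_top.mp hL))
      obtain ⟨y, hy⟩ : ∃ y, y ∉ LinearMap.range L := by
        by_contra! hall
        exact hL (Submodule.eq_top_iff'.mpr hall)
      -- Gram-Schmidt: a nonzero corner `e a ≫ y'` of the remainder has a multiple that extends `x`
      let y' := y - ∑ i, (y ≫ (x i)†) ≫ x i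
      have hy' : y' ≠ 0 := fun h0 => hy ⟨fun i => y ≫ (x i)†, (sub_eq_zero.mp h0).symm⟩
      have horth : ∀ j, y' ≫ (x j)† = 0 := by
        intro j
        simp only [y', Preadditive.sub_comp, Preadditive.sum_comp, Category.assoc]
        rw [Finset.sum_eq_single j]
        · have := congrArg CStarCategory.dagger (hx2 j)
          simp only [CStarCategory.dagger_comp, CStarCategory.dagger_dagger,
            Category.assoc] at this
          rw [this, sub_self]
        · intro i _ hij
          simp [hx1 i j hij]
        · simp
      have hsum : ∑ a, e a = (1 : CEnd (𝟙 M)) :=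
        hinj _ _ fun a => by simp [he]
      obtain ⟨a, ha⟩ : ∃ a, (e a : 𝟙 M ⟶ 𝟙 M) ≫ y' ≠ 0 := by
        by_contra! hall
        apply hy'
        have h1 : (∑ a, e a : 𝟙 M ⟶ 𝟙 M) ≫ y' = 0 := by
          rw [Preadditive.sum_comp]
          exact Finset.sum_eq_zero fun a _ => hall a
        have h2 : (∑ a, e a : 𝟙 M ⟶ 𝟙 M) = 𝟙 _ := hsum
        rwa [h2, Category.id_comp] at h1
      let q : 𝟙 M ⟶ X := e a ≫ y'
      have hstar : (e a : 𝟙 M ⟶ 𝟙 M)† = e a := by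
        change star (e a) = e a
        refine hinj _ _ fun b => ?_
        rw [map_star, he]; split_ifs <;> simp
      have hq : q ≫ q† = (χ a (y' ≫ y'†)) • (e a : 𝟙 M ⟶ 𝟙 M) := by
        have : q ≫ q† = e a * (y' ≫ y'† : 𝟙 M ⟶ 𝟙 M) * e a := by
          change (e a ≫ y') ≫ (e a ≫ y')† = (e a ≫ y' ≫ y'†) ≫ e a
          simp [hstar]
        rw [this]
        refine hinj _ _ fun b => ?_
        rw [map_mul, map_mul, map_smul, he]
        split_ifs with hb
        · subst hb; simp
        · simp
      obtain ⟨r, hr, hr'⟩ := exists_nonneg_eq (χ a) y'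
      have hea : ‖e a‖ = 1 := by
        have h1 : e a * star (e a) = e a := by
          refine hinj _ _ fun b => ?_
          rw [map_mul, map_star, he]; split_ifs <;> simp
        have h2 : ‖e a‖ * ‖e a‖ = ‖e a‖ := by
          rw [← CStarRing.norm_self_mul_star, h1]
        have h3 : e a ≠ 0 := fun h0 => by
          have := he a a
          rw [h0] at this; simp at this
        exact mul_left_cancel₀ (norm_ne_zero_iff.mpr h3) (by rw [h2, mul_one])
      have hqn : ‖q‖ ^ 2 = r := by
        rw [← CStarCategory.norm_comp_dagger, hq, hr', norm_smul]
        have : ‖(e a : 𝟙 M ⟶ 𝟙 M)‖ = 1 := hea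
        rw [this]; simp [abs_of_nonneg hr]
      have hq0 : ‖q‖ ≠ 0 := norm_ne_zero_iff.mpr ha
      let x' : 𝟙 M ⟶ X := ((‖q‖⁻¹ : ℝ) : ℂ) • q
      have hx'e : x' ≫ x'† = e a := by
        simp only [x', CStarCategory.dagger_smul, Linear.smul_comp, Linear.comp_smul, hq, hr',
          smul_smul, ← hqn, Complex.conj_ofReal]
        have : ((‖q‖⁻¹ : ℝ) : ℂ) * (((‖q‖⁻¹ : ℝ) : ℂ) * ((‖q‖ ^ 2 : ℝ) : ℂ)) = 1 := by
          norm_cast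
          field_simp
        rw [this, one_smul]
      have hx'o : ∀ j, x' ≫ (x j)† = 0 := by
        intro j
        simp only [x', q, Linear.smul_comp, Category.assoc, horth, Limits.comp_zero, smul_zero]
      have hx'o' : ∀ j, x j ≫ x'† = 0 := by
        intro j
        have := congrArg CStarCategory.dagger (hx'o j)
        simpa using this
      have hx'n : ‖x'‖ = 1 := by
        simp only [x', norm_smul, Complex.norm_real, norm_inv, norm_norm]
        exact inv_mul_cancel₀ hq0
      have hee : (e a : 𝟙 M ⟶ 𝟙 M) ≫ e a = e a := by
        change e a * e a = e a
        refine hinj _ _ fun b => ?_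
        rw [map_mul, he]; split_ifs <;> simp
      refine ⟨Fin.cons x' x, ?_, ?_, ?_⟩
      · intro i j
        refine Fin.cases ?_ (fun i => ?_) i <;> refine Fin.cases ?_ (fun j => ?_) j
        · intro h; exact absurd rfl h
        · intro _; simpa using hx'o j
        · intro _; simpa using hx'o' i
        · intro h; simpa using hx1 i j (fun hij => h (by rw [hij]))
      · intro i
        refine Fin.cases ?_ (fun i => ?_) i
        · simp only [Fin.cons_zero]
          rw [← Category.assoc, hx'e]
          simp only [x', q, Linear.comp_smul]
          rw [← Category.assoc, hee]
        · simpa using hx2 i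
      · intro i
        refine Fin.cases ?_ (fun i => ?_) i
        · simp [hx'n]
        · simpa using hx3 i
  obtain ⟨x, h1, h2, h3⟩ := key (N + 1)
  have := hN (N + 1) x h1 h2 h3
  omega

end Finite

/-! ### Central partitions and optimal special twists -/

section CentralProjections

variable {B : Type u} [Bicategory.{w, v} B] [CStarBicategory B] {M : B}

/-- The endomorphisms of the horizontal unit whose two actions on `X` agree. -/
def balancedCenter (X : M ⟶ M) : StarSubalgebra ℂ (CEnd (𝟙 M)) where
  carrier := {z | sourceAct X z = targetAct X z}
  mul_mem' {z z'} hz hz' := by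
    change sourceAct X (z ≫ z') = targetAct X (z ≫ z')
    rw [sourceAct_comp, targetAct_comp, hz, hz']
  add_mem' {z z'} hz hz' := by
    change sourceAct X (z + z') = targetAct X (z + z')
    rw [sourceAct_add, targetAct_add, hz, hz']
  algebraMap_mem' c := by
    change sourceAct X (c • 𝟙 _) = targetAct X (c • 𝟙 _)
    rw [sourceAct_smul, targetAct_smul, sourceAct_id, targetAct_id]
  star_mem' {z} hz := by
    change sourceAct X (z†) = targetAct X (z†)
    rw [← dagger_sourceAct, ← dagger_targetAct, hz]

/-- A partition of unity of the horizontal unit into projections whose two actions on `X` agree and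
which are minimal with this property. -/
structure IsCentralPartition (X : M ⟶ M) {n : ℕ} (z : Fin n → (𝟙 M ⟶ 𝟙 M)) : Prop where
  ne_zero : ∀ i, z i ≠ 0
  dagger : ∀ i, (z i)† = z i
  idem : ∀ i, z i ≫ z i = z i
  orthogonal : ∀ i j, i ≠ j → z i ≫ z j = 0
  sum_eq : ∑ i, z i = 𝟙 _
  balanced : ∀ i, sourceAct X (z i) = targetAct X (z i)
  minimal : ∀ i (y : 𝟙 M ⟶ 𝟙 M), sourceAct X y = targetAct X y → ∃ c : ℂ, z i ≫ y = c • z i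

lemma exists_isCentralPartition (hfin : FiniteDimensional ℂ (𝟙 M ⟶ 𝟙 M)) (X : M ⟶ M) :
    ∃ (n : ℕ) (z : Fin n → (𝟙 M ⟶ 𝟙 M)), IsCentralPartition X z := by
  have : FiniteDimensional ℂ (CEnd (𝟙 M)) := hfin
  have : IsClosed (balancedCenter X : Set (CEnd (𝟙 M))) :=
    Submodule.closed_of_finiteDimensional
      (Subalgebra.toSubmodule (balancedCenter X).toSubalgebra)
  have : FiniteDimensional ℂ (balancedCenter X) :=
    inferInstanceAs (FiniteDimensional ℂ
      (Subalgebra.toSubmodule (balancedCenter X).toSubalgebra))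
  obtain ⟨n, e, χ, he, hinj, -⟩ := exists_minimal_projections (balancedCenter X)
  have hmul : ∀ i (y : balancedCenter X), e i * y = χ i y • e i := by
    intro i y
    refine hinj _ _ fun b => ?_
    rw [map_mul, map_smul, he]
    split_ifs with hb
    · subst hb; simp
    · simp
  refine ⟨n, fun i => (e i : CEnd (𝟙 M)), ?_, ?_, ?_, ?_, ?_, fun i => (e i).2, ?_⟩
  · intro i h0
    have h1 : e i = 0 := Subtype.ext h0
    have := he i i
    rw [h1] at this
    simp at this
  · intro i
    have : star (e i) = e i := by
      refine hinj _ _ fun b => ?_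
      rw [map_star, he]; split_ifs <;> simp
    exact congrArg Subtype.val this
  · intro i
    have : e i * e i = e i := by rw [hmul, he]; simp
    exact congrArg Subtype.val this
  · intro i j hij
    have : e i * e j = 0 := by rw [hmul, he, if_neg hij, zero_smul]
    exact congrArg Subtype.val this
  · have : ∑ i, e i = 1 := hinj _ _ fun b => by simp [he]
    have h2 : ∑ i, (e i : CEnd (𝟙 M)) = 1 := by
      simpa using congrArg (fun x : balancedCenter X => (x : CEnd (𝟙 M))) this
    exact h2
  · intro i y hy
    exact ⟨χ i ⟨y, hy⟩, congrArg Subtype.val (hmul i ⟨y, hy⟩)⟩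

end CentralProjections

namespace Alg

variable {B : Type u} [Bicategory.{w, v} B] [CStarBicategory B] {M : B} {A : Alg M}

variable (A) in
/-- `leftAverage` as a linear map. -/
def leftAverageₗ : (A.obj ⟶ A.obj) →ₗ[ℂ] (A.obj ⟶ A.obj) where
  toFun := A.leftAverage
  map_add' x y := by simp [leftAverage, CStarBicategory.add_whiskerRight]
  map_smul' c x := by simp [leftAverage, CStarBicategory.smul_whiskerRight]

/-- The C*-algebra of right linear endomorphisms of a special C*-Frobenius algebra. -/
def rightLinearEnd (hA : A.IsCStarFrobenius) (hs : A.IsSpecial) :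
    StarSubalgebra ℂ (CEnd A.obj) where
  carrier := {x | A.IsRightLinear x}
  mul_mem' hx hy := hx.comp hy
  add_mem' {x y} hx hy := by
    change A.mul ≫ (x + y) = A.obj ◁ (x + y) ≫ A.mul
    have hx : A.mul ≫ x = A.obj ◁ x ≫ A.mul := hx
    have hy : A.mul ≫ y = A.obj ◁ y ≫ A.mul := hy
    rw [CStarBicategory.whiskerLeft_add, Preadditive.comp_add, Preadditive.add_comp, hx, hy]
  algebraMap_mem' c := by
    change A.mul ≫ (c • 𝟙 A.obj) = A.obj ◁ (c • 𝟙 A.obj) ≫ A.mul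
    simp [CStarBicategory.whiskerLeft_smul]
  star_mem' hx := hA.dagger_right hs hx

variable {hA : A.IsCStarFrobenius} {hs : A.IsSpecial}

lemma finiteDimensional_rightLinearEnd (hfin : FiniteDimensional ℂ (𝟙 M ⟶ 𝟙 M)) :
    FiniteDimensional ℂ (rightLinearEnd hA hs) := by
  have := hA.isConjugateSolution.finiteDimensional hfin
  let L : rightLinearEnd hA hs →ₗ[ℂ] (𝟙 M ⟶ A.obj) :=
    { toFun := fun x => A.one ≫ (x : CEnd A.obj)
      map_add' := fun x y => Preadditive.comp_add _ _ _ _ _ _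
      map_smul' := fun c x => Linear.comp_smul _ _ _ _ _ _ }
  refine FiniteDimensional.of_injective L fun x y hxy => Subtype.ext ?_
  exact IsRightLinear.eq_of_one x.2 y.2 hxy

lemma isClosed_rightLinearEnd (hfin : FiniteDimensional ℂ (𝟙 M ⟶ 𝟙 M)) :
    IsClosed (rightLinearEnd hA hs : Set (CEnd A.obj)) := by
  have : FiniteDimensional ℂ
      (Subalgebra.toSubmodule (rightLinearEnd hA hs).toSubalgebra) :=
    finiteDimensional_rightLinearEnd (hA := hA) (hs := hs) hfin
  exact Submodule.closed_of_finiteDimensional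
    (Subalgebra.toSubmodule (rightLinearEnd hA hs).toSubalgebra)

variable (A) in
/-- `t` is right linear with inverse `v`, and the algebra transported along `t` is special, that is
`m (1_A ⊗ v v*) m* = 1`. -/
structure IsSpecialTwist (t v : A.obj ⟶ A.obj) : Prop where
  right : A.IsRightLinear t
  right_inv : A.IsRightLinear v
  comp_inv : t ≫ v = 𝟙 _
  inv_comp : v ≫ t = 𝟙 _
  special : A.leftAverage (v† ≫ v) = 𝟙 _

lemma norm_le_of_leftAverage_eq (v : A.obj ⟶ A.obj) (hv : A.leftAverage (v† ≫ v) = 𝟙 _) :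
    ‖v‖ ≤ ‖(ρ_ A.obj).inv ≫ A.obj ◁ A.one‖ := by
  have h1 : v = ((ρ_ A.obj).inv ≫ A.obj ◁ A.one) ≫ v ▷ A.obj ≫ A.mul := by
    rw [Category.assoc, whisker_exchange_assoc, A.one_mul]; simp
  have h2 : ‖v ▷ A.obj ≫ A.mul‖ ≤ 1 := by
    have h3 := CStarCategory.norm_comp_dagger ((v ▷ A.obj ≫ A.mul)†)
    have h4 : (v ▷ A.obj ≫ A.mul)† ≫ (v ▷ A.obj ≫ A.mul)†† = 𝟙 _ := by
      rw [← hv]; simp [leftAverage]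
    rw [h4, norm_dagger] at h3
    have := norm_id_le A.obj
    rw [h3] at this
    exact (sq_le_one_iff₀ (norm_nonneg _)).mp this
  calc ‖v‖ = ‖((ρ_ A.obj).inv ≫ A.obj ◁ A.one) ≫ v ▷ A.obj ≫ A.mul‖ := by rw [← h1]
    _ ≤ _ := CStarCategory.norm_comp_le _ _
    _ ≤ _ := mul_le_of_le_one_right (norm_nonneg _) h2

lemma IsRightLinear.norm_le {t : A.obj ⟶ A.obj} (ht : A.IsRightLinear t) :
    ‖t‖ ≤ ‖(ρ_ A.obj).inv‖ * (‖A.one ≫ t‖ * ‖A.mul‖) := by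
  conv_lhs => rw [← ht.leftMul_eq]
  refine (CStarCategory.norm_comp_le _ _).trans ?_
  gcongr
  refine (CStarCategory.norm_comp_le _ _).trans ?_
  gcongr
  exact norm_whiskerLeft_le _ _

/-- Among the special twists some `t` has the least `∑ i, ‖t ι z i‖`. The inverse `v` of a special
twist is bounded because `m (1_A ⊗ v)` is a coisometry, and `t` is bounded by the norm of `t ι`, so
the special twists that do not exceed `t = 1` form a compact set. -/
lemma exists_optimal_twist (hA : A.IsCStarFrobenius) (hs : A.IsSpecial)
    (hfin : FiniteDimensional ℂ (𝟙 M ⟶ 𝟙 M)) {n : ℕ} {z : Fin n → (𝟙 M ⟶ 𝟙 M)}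
    (hz : IsCentralPartition A.obj z) :
    ∃ t v, A.IsSpecialTwist t v ∧ ∀ t' v', A.IsSpecialTwist t' v' →
      ∑ i, ‖z i ≫ A.one ≫ t‖ ≤ ∑ i, ‖z i ≫ A.one ≫ t'‖ := by
  let E := rightLinearEnd hA hs
  have : FiniteDimensional ℂ E := finiteDimensional_rightLinearEnd hfin
  have : ProperSpace E := FiniteDimensional.proper ℂ E
  let F : E →ₗ[ℂ] (A.obj ⟶ A.obj) := A.leftAverageₗ ∘ₗ E.subtype.toAlgHom.toLinearMap
  have hF : Continuous F := F.continuous_of_finiteDimensional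
  let G : Fin n → E →ₗ[ℂ] (𝟙 M ⟶ A.obj) := fun i =>
    { toFun := fun x => z i ≫ A.one ≫ (x : CEnd A.obj)
      map_add' := fun x y => by
        change z i ≫ A.one ≫ ((x : A.obj ⟶ A.obj) + (y : CEnd A.obj)) = _
        simp only [Preadditive.comp_add]
      map_smul' := fun c x => by
        change z i ≫ A.one ≫ (c • (x : A.obj ⟶ A.obj)) = _
        simp only [Linear.comp_smul]; rfl }
  have hG : ∀ i, Continuous (G i) := fun i => (G i).continuous_of_finiteDimensional
  let f : E → ℝ := fun x => ∑ i, ‖G i x‖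
  have hf : Continuous f := continuous_finsetSum _ fun i _ => (hG i).norm
  let S : Set (E × E) := {q | q.1 * q.2 = 1 ∧ q.2 * q.1 = 1 ∧ F (star q.2 * q.2) = 𝟙 _ ∧
    f q.1 ≤ f 1}
  have hone : ((1 : E), (1 : E)) ∈ S := by
    refine ⟨_root_.mul_one _, _root_.mul_one _, ?_, le_rfl⟩
    change F (star (1 : E) * 1) = _
    rw [star_one, _root_.mul_one]
    exact IsLeftLinear.leftAverage_eq hs (show A.mul ≫ 𝟙 A.obj = 𝟙 A.obj ▷ A.obj ≫ A.mul by simp)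
  have hclosed : IsClosed S := by
    refine IsClosed.and (isClosed_eq (by fun_prop) continuous_const) ?_
    refine IsClosed.and (isClosed_eq (by fun_prop) continuous_const) ?_
    refine IsClosed.and (isClosed_eq (hF.comp (by fun_prop)) continuous_const) ?_
    exact isClosed_le (hf.comp continuous_fst) continuous_const
  have hbdd : Bornology.IsBounded S := by
    let C1 := ‖(ρ_ A.obj).inv‖ * (f 1 * ‖A.mul‖)
    let C2 := ‖(ρ_ A.obj).inv ≫ A.obj ◁ A.one‖
    refine (Metric.isBounded_closedBall (x := (0 : E × E)) (r := max C1 C2)).subset ?_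
    rintro ⟨t, v⟩ ⟨h1, h2, h3, h4⟩
    rw [mem_closedBall_zero_iff, Prod.norm_def]
    refine max_le_max ?_ ?_
    · have h5 : ‖A.one ≫ (t : A.obj ⟶ A.obj)‖ ≤ f t := by
        have : A.one ≫ (t : A.obj ⟶ A.obj) = ∑ i, G i t := by
          change _ = ∑ i, z i ≫ A.one ≫ (t : A.obj ⟶ A.obj)
          rw [← Preadditive.sum_comp, hz.sum_eq, Category.id_comp]
        rw [this]
        exact norm_sum_le _ _
      refine (IsRightLinear.norm_le t.2).trans ?_
      change _ ≤ ‖(ρ_ A.obj).inv‖ * (f 1 * ‖A.mul‖)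
      gcongr
      exact h5.trans h4
    · exact norm_le_of_leftAverage_eq _ h3
  have hcpt : IsCompact S := Metric.isCompact_of_isClosed_isBounded hclosed hbdd
  obtain ⟨⟨t, v⟩, ⟨h1, h2, h3, h4⟩, hmin⟩ :=
    hcpt.exists_isMinOn ⟨_, hone⟩ (hf.comp continuous_fst).continuousOn
  refine ⟨t.1, v.1, ⟨t.2, v.2, congrArg Subtype.val h1, congrArg Subtype.val h2, h3⟩, ?_⟩
  intro t' v' h
  by_cases hle : f ⟨t', h.right⟩ ≤ f 1
  · exact hmin (a := (⟨t', h.right⟩, ⟨v', h.right_inv⟩))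
      ⟨Subtype.ext h.comp_inv, Subtype.ext h.inv_comp, h.special, hle⟩
  · exact h4.trans (not_le.mp hle).le

end Alg

/-! ### The first-order condition at an optimum -/

namespace Alg

variable {B : Type u} [Bicategory.{w, v} B] [CStarBicategory B] {M : B} {A : Alg M}

/-- `φ` is a state on the center `End(1_M)` supported under the projection `z`, with
`φ(ι* ι) = ‖ι z‖²`, such that `x ↦ φ(ι* x ι)` factors through `leftAverage` on the right linear
endomorphisms. Normalisation is expressed by `norm_le` and `attained`. -/
structure IsBalancingState (A : Alg M) (z : 𝟙 M ⟶ 𝟙 M) (φ : (𝟙 M ⟶ 𝟙 M) →ₗ[ℂ] ℂ) : Prop where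
  nonneg : ∀ {Y : M ⟶ M} (y : 𝟙 M ⟶ Y), ∃ r : ℝ, 0 ≤ r ∧ φ (y ≫ y†) = r
  norm_le : ∀ x, ‖φ x‖ ≤ ‖x‖
  absorb : ∀ x, φ (z ≫ x) = φ x
  attained : φ (A.one ≫ A.one†) = (‖z ≫ A.one‖ ^ 2 : ℝ)
  balanced : ∀ x, A.IsRightLinear x → φ (A.one ≫ x ≫ A.one†) = φ (A.one ≫ A.leftAverage x ≫ A.one†)

/-- Characters are real on selfadjoint elements. -/
lemma im_char_eq_zero {C : Type v} [Category.{w} C] [CStarCategory C] {X : C}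
    (χ : CEnd X →⋆ₐ[ℂ] ℂ) (x : X ⟶ X) (hx : x† = x) : (χ x).im = 0 := by
  have h : χ (star (x : CEnd X)) = star (χ x) := map_star χ _
  have h2 : star (x : CEnd X) = x := hx
  rw [h2] at h
  exact Complex.conj_eq_iff_im.mp h.symm

open Filter Topology in
/-- First-order condition at an optimal algebra: otherwise a small selfadjoint perturbation `s` with
`leftAverage s = 0` leads to the better special twist `(1 + δ s)^(-1/2)`. -/
lemma exists_char_nonpos (hA : A.IsCStarFrobenius) (hs : A.IsSpecial)
    (hfin : FiniteDimensional ℂ (𝟙 M ⟶ 𝟙 M)) {n : ℕ} {z : Fin n → (𝟙 M ⟶ 𝟙 M)}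
    (hz : IsCentralPartition A.obj z)
    (hopt : ∀ t v, A.IsSpecialTwist t v → ∑ i, ‖z i ≫ A.one‖ ≤ ∑ i, ‖z i ≫ A.one ≫ t‖)
    {k : ℕ} (χ : Fin k → CEnd (𝟙 M) →⋆ₐ[ℂ] ℂ)
    (hinj : ∀ x y, (∀ a, χ a x = χ a y) → x = y)
    (hnorm : ∀ x (r : ℝ), 0 ≤ r → (∀ a, ‖χ a x‖ ≤ r) → ‖x‖ ≤ r)
    (i : Fin n) (s : A.obj ⟶ A.obj) (hsr : A.IsRightLinear s) (hsa : s† = s)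
    (hs0 : A.leftAverage s = 0) :
    ∃ a, χ a (z i) = 1 ∧ (χ a (A.one ≫ A.one†)).re = ‖z i ≫ A.one‖ ^ 2 ∧
      (χ a (A.one ≫ s ≫ A.one†)).re ≤ 0 := by
  by_contra! hcon
  let E := rightLinearEnd hA hs
  have : FiniteDimensional ℂ E := finiteDimensional_rightLinearEnd hfin
  have : IsClosed (E : Set (CEnd A.obj)) := isClosed_rightLinearEnd hfin
  -- the part of the perturbation under `z i`
  let p : A.obj ⟶ A.obj := sourceAct A.obj (z i)
  have hpl : A.IsLeftLinear p := isLeftLinear_sourceAct A (z i)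
  have hpr : A.IsRightLinear p := by
    have := isRightLinear_targetAct A (z i)
    rwa [← hz.balanced i] at this
  have hpd : p† = p := by rw [dagger_sourceAct, hz.dagger]
  have hps : ∀ f : A.obj ⟶ A.obj, p ≫ f = f ≫ p := fun f => sourceAct_naturality f _
  have hop : A.one ≫ p = z i ≫ A.one := comp_sourceAct _ _
  let s' : E := ⟨p ≫ s, hpr.comp hsr⟩
  have hs'sa : star s' = s' := by
    refine Subtype.ext ?_
    change (p ≫ s)† = p ≫ s
    rw [CStarCategory.dagger_comp, hsa, hpd, hps]
  have hs'0 : A.leftAverage (p ≫ s) = 0 := by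
    have hpl' : A.mul ≫ p = p ▷ A.obj ≫ A.mul := hpl
    have : A.leftAverage (p ≫ s) = A.leftAverage s ≫ p := by
      rw [hps, leftAverage, leftAverage, comp_whiskerRight, Category.assoc, ← hpl']; simp
    rw [this, hs0, Limits.zero_comp]
  let F : E →ₗ[ℂ] CEnd (𝟙 M) :=
    { toFun := fun x => A.one ≫ (x : CEnd A.obj) ≫ A.one†
      map_add' := fun x y => by
        change A.one ≫ ((x : A.obj ⟶ A.obj) + (y : CEnd A.obj)) ≫ A.one† = _
        simp only [Preadditive.comp_add, Preadditive.add_comp]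
      map_smul' := fun c x => by
        change A.one ≫ (c • (x : A.obj ⟶ A.obj)) ≫ A.one† = _
        simp only [Linear.comp_smul, Linear.smul_comp]; rfl }
  have hF : Continuous F := F.continuous_of_finiteDimensional
  have hχ : ∀ a, Continuous fun x : E => (χ a (F x)).re := fun a =>
    Complex.continuous_re.comp
      (((χ a).toAlgHom.toLinearMap ∘ₗ F).continuous_of_finiteDimensional)
  let h : ℝ → E := fun δ => Ring.inverse (1 + (δ : ℂ) • s')
  have hlim0 : Tendsto (fun δ : ℝ => (1 : E) + (δ : ℂ) • s') (𝓝[>] 0) (𝓝 1) := by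
    have : Continuous fun δ : ℝ => (1 : E) + (δ : ℂ) • s' := by fun_prop
    have := (this.tendsto 0).mono_left (nhdsWithin_le_nhds (s := Set.Ioi 0))
    simpa using this
  have hlim : Tendsto h (𝓝[>] 0) (𝓝 1) := by
    have h1 : ContinuousAt (Ring.inverse : E → E) ((1 : Eˣ) : E) :=
      NormedRing.inverse_continuousAt 1
    have h2 := h1.tendsto.comp (f := fun δ : ℝ => (1 : E) + (δ : ℂ) • s') (x := 𝓝[>] 0)
      (by simpa using hlim0)
    rw [Units.val_one, Ring.inverse_one] at h2
    exact h2
  have hsmall : ∀ᶠ δ : ℝ in 𝓝[>] 0, ‖(δ : ℂ) • s'‖ < 1 := by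
    have h1 : Continuous fun δ : ℝ => ‖(δ : ℂ) • s'‖ := by fun_prop
    have h2 := (h1.tendsto 0).mono_left (nhdsWithin_le_nhds (s := Set.Ioi 0))
    exact h2.eventually_lt_const (by simp)
  have hle : ∀ a, χ a (z i) = 1 → (χ a (A.one ≫ A.one†)).re ≤ ‖z i ≫ A.one‖ ^ 2 := by
    intro a ha
    have h1 : (χ a (A.one ≫ A.one†)) = χ a ((z i ≫ A.one) ≫ (z i ≫ A.one)†) := by
      have : (z i ≫ A.one) ≫ (z i ≫ A.one)† = (z i : CEnd (𝟙 M)) * (A.one ≫ A.one†) * z i := by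
        change _ = (z i ≫ (A.one ≫ A.one†)) ≫ z i
        simp [hz.dagger]
      rw [this, map_mul, map_mul, ha]; simp
    rw [h1, ← CStarCategory.norm_comp_dagger]
    exact (Complex.re_le_norm _).trans (NonUnitalStarAlgHom.norm_apply_le (χ a) _)
  -- for small perturbations all the relevant characters decrease
  have hdec : ∀ᶠ δ : ℝ in 𝓝[>] 0, ∀ a, χ a (z i) = 1 →
      (χ a (F (h δ))).re < ‖z i ≫ A.one‖ ^ 2 := by
    rw [eventually_all]
    intro a
    by_cases ha : χ a (z i) = 1
    swap
    · exact Eventually.of_forall fun δ h => absurd h ha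
    have hF1 : F 1 = A.one ≫ A.one† := by
      change A.one ≫ 𝟙 _ ≫ A.one† = _
      rw [Category.id_comp]
    rcases (hle a ha).lt_or_eq with hlt | heq
    · have h1 : Tendsto (fun δ => (χ a (F (h δ))).re) (𝓝[>] 0) (𝓝 (χ a (F 1)).re) :=
        ((hχ a).tendsto 1).comp hlim
      rw [hF1] at h1
      filter_upwards [h1.eventually_lt_const hlt] with δ hδ _ using hδ
    · have h1 : Tendsto (fun δ => (χ a (F (s' * h δ))).re) (𝓝[>] 0) (𝓝 (χ a (F (s' * 1))).re) :=
        ((hχ a).tendsto _).comp (tendsto_const_nhds.mul hlim)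
      have h2 : χ a (F (s' * 1)) = χ a (A.one ≫ s ≫ A.one†) := by
        have : F (s' * 1) = (z i : CEnd (𝟙 M)) * (A.one ≫ s ≫ A.one†) := by
          rw [_root_.mul_one]
          change A.one ≫ (p ≫ s) ≫ A.one† = z i ≫ (A.one ≫ s ≫ A.one†)
          rw [Category.assoc, reassoc_of% hop]
        rw [this, map_mul, ha, _root_.one_mul]
      rw [h2] at h1
      filter_upwards [h1.eventually_const_lt (hcon a ha heq), hsmall, self_mem_nhdsWithin]
        with δ hδ hδ' hpos _
      have hu : IsUnit (1 + (δ : ℂ) • s') := by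
        obtain ⟨v, -, hv, hvu⟩ := exists_selfAdjoint_sqrt (s := (δ : ℂ) • s')
          (by rw [star_smul, hs'sa]; simp) hδ'
        rw [← hv]; exact hvu.mul hvu
      have h3 : h δ = 1 - (δ : ℂ) • (s' * h δ) := by
        have := Ring.mul_inverse_cancel _ hu
        rw [_root_.add_mul, _root_.one_mul, smul_mul_assoc] at this
        exact eq_sub_of_add_eq this
      rw [h3, map_sub, map_smul, map_sub, map_smul, hF1, Complex.sub_re, heq]
      have : 0 < δ * (χ a (F (s' * h δ))).re := mul_pos hpos hδ
      simpa using this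
  obtain ⟨δ, hδ, hdecδ⟩ := (hsmall.and hdec).exists
  obtain ⟨v, hvsa, hvv, hvu⟩ := exists_selfAdjoint_sqrt (s := (δ : ℂ) • s')
    (by rw [star_smul, hs'sa]; simp) hδ
  obtain ⟨u, rfl⟩ := hvu
  let t : E := ((u⁻¹ : Eˣ) : E)
  have htsa : star t = t := by
    have h1 : star t * u = 1 := by
      have : star ((u : E) * t) = 1 := by simp [t]
      rwa [star_mul, hvsa] at this
    calc star t = star t * (u * t) := by simp [t]
      _ = t := by rw [← _root_.mul_assoc, h1, _root_.one_mul]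
  have htt : t * star t = h δ := by
    have h1 : h δ = Ring.inverse ((u * u : Eˣ) : E) := by
      simp only [h]; rw [← hvv, Units.val_mul]
    rw [h1, Ring.inverse_unit, htsa]
    simp [t]
  have htw : A.IsSpecialTwist (t : CEnd A.obj) ((u : E) : CEnd A.obj) := by
    refine ⟨t.2, (u : E).2, congrArg Subtype.val (u.inv_mul), congrArg Subtype.val (u.mul_inv), ?_⟩
    have h1 : star (u : E) * u = 1 + (δ : ℂ) • s' := by rw [hvsa, hvv]
    have h2 := congrArg (fun x : E => A.leftAverageₗ (x : CEnd A.obj)) h1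
    have h3 : A.leftAverage (𝟙 _) = 𝟙 _ :=
      IsLeftLinear.leftAverage_eq hs (show A.mul ≫ 𝟙 A.obj = 𝟙 A.obj ▷ A.obj ≫ A.mul by simp)
    change A.leftAverageₗ _ = A.leftAverageₗ (𝟙 A.obj + (δ : ℂ) • (p ≫ s)) at h2
    rw [map_add, map_smul] at h2
    change A.leftAverage _ = A.leftAverage _ + _ • A.leftAverage _ at h2
    rw [hs'0, h3, smul_zero, add_zero] at h2
    exact h2
  have hcompare := hopt _ _ htw
  have hsq : ∀ j, (z j ≫ A.one ≫ (t : CEnd A.obj)) ≫ (z j ≫ A.one ≫ (t : CEnd A.obj))† =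
      z j ≫ F (h δ) ≫ z j := by
    intro j
    have : F (h δ) = A.one ≫ ((t : A.obj ⟶ A.obj) ≫ (t : A.obj ⟶ A.obj)†) ≫ A.one† := by
      rw [← htt]; rfl
    rw [this]
    simp [hz.dagger]
  -- the components other than the `i`-th are not affected
  have hother : ∀ j, j ≠ i → ‖z j ≫ A.one ≫ (t : CEnd A.obj)‖ = ‖z j ≫ A.one‖ := by
    intro j hj
    have hu : IsUnit (1 + (δ : ℂ) • s') := by
      rw [← hvv]; exact u.isUnit.mul u.isUnit
    have h3 : h δ = 1 - (δ : ℂ) • (s' * h δ) := by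
      have := Ring.mul_inverse_cancel _ hu
      rw [_root_.add_mul, _root_.one_mul, smul_mul_assoc] at this
      exact eq_sub_of_add_eq this
    have h4 : z j ≫ F (s' * h δ) = 0 := by
      change z j ≫ A.one ≫ ((p ≫ s) ≫ (h δ : CEnd A.obj)) ≫ A.one† = 0
      simp only [Category.assoc]
      rw [reassoc_of% hop, ← Category.assoc, hz.orthogonal j i hj, Limits.zero_comp]
    have h5 : z j ≫ F (h δ) = z j ≫ A.one ≫ A.one† := by
      rw [h3, map_sub, map_smul]
      have h6 : z j ≫ (F 1 - (δ : ℂ) • F (s' * h δ) : 𝟙 M ⟶ 𝟙 M) =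
          z j ≫ F 1 - (δ : ℂ) • (z j ≫ F (s' * h δ)) := by
        rw [Preadditive.comp_sub, Linear.comp_smul]
      refine h6.trans ?_
      rw [h4, smul_zero, sub_zero]
      change z j ≫ A.one ≫ 𝟙 _ ≫ A.one† = _
      rw [Category.id_comp]
    have h7 : ‖z j ≫ A.one ≫ (t : CEnd A.obj)‖ ^ 2 = ‖z j ≫ A.one‖ ^ 2 := by
      rw [← CStarCategory.norm_comp_dagger, ← CStarCategory.norm_comp_dagger, hsq,
        ← Category.assoc, h5]
      simp [hz.dagger]
    exact (sq_eq_sq₀ (norm_nonneg _) (norm_nonneg _)).mp h7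
  have hi : ‖z i ≫ A.one‖ ≤ ‖z i ≫ A.one ≫ (t : CEnd A.obj)‖ := by
    rw [← Finset.add_sum_erase _ _ (Finset.mem_univ i),
      ← Finset.add_sum_erase _ (fun j => ‖z j ≫ A.one ≫ (t : CEnd A.obj)‖) (Finset.mem_univ i),
      Finset.sum_congr rfl fun j hj => hother j (Finset.ne_of_mem_erase hj)] at hcompare
    linarith
  -- some character attains the norm of the `i`-th component
  have hχz : ∀ a, χ a (z i) = 0 ∨ χ a (z i) = 1 := by
    intro a
    have h1 : χ a (z i) * χ a (z i) = χ a (z i) := by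
      rw [← map_mul]; exact congrArg (χ a) (hz.idem i)
    rcases eq_or_ne (χ a (z i)) 0 with h0 | h0
    · exact Or.inl h0
    · exact Or.inr (mul_left_cancel₀ h0 (by rw [h1, _root_.mul_one]))
  obtain ⟨a₀, ha₀⟩ : ∃ a, χ a (z i) = 1 := by
    by_contra! hall
    refine hz.ne_zero i (hinj _ _ fun a => ?_)
    rcases hχz a with h0 | h1
    · rw [h0]; exact (map_zero (χ a)).symm
    · exact absurd h1 (hall a)
  let D : Finset (Fin k) := Finset.univ.filter fun a => χ a (z i) = 1
  obtain ⟨b, hbD, hb⟩ := D.exists_max_image (fun a => (χ a (F (h δ))).re) ⟨a₀, by simp [D, ha₀]⟩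
  have hbz : χ b (z i) = 1 := by simpa [D] using hbD
  have hpos : ∀ a, ∃ r : ℝ, 0 ≤ r ∧ χ a (F (h δ)) = r := by
    intro a
    have : F (h δ) = (A.one ≫ (t : A.obj ⟶ A.obj)) ≫ (A.one ≫ (t : A.obj ⟶ A.obj))† := by
      rw [← htt]
      change A.one ≫ ((t : A.obj ⟶ A.obj) ≫ (t : A.obj ⟶ A.obj)†) ≫ A.one† = _
      simp
    rw [this]
    exact exists_nonneg_eq (χ a) _
  have hre : 0 ≤ (χ b (F (h δ))).re := by
    obtain ⟨r, hr, hr'⟩ := hpos b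
    rw [hr']; simpa using hr
  have hfinal : ‖z i ≫ A.one ≫ (t : CEnd A.obj)‖ ^ 2 ≤ (χ b (F (h δ))).re := by
    rw [← CStarCategory.norm_comp_dagger, hsq]
    refine hnorm _ _ hre fun a => ?_
    have h1 : χ a (z i ≫ F (h δ) ≫ z i) = χ a (z i) * (χ a (F (h δ)) * χ a (z i)) := by
      rw [← map_mul, ← map_mul]; rfl
    rw [h1]
    rcases hχz a with h0 | h0
    · simp [h0, hre]
    · obtain ⟨r, hr, hr'⟩ := hpos a
      have h2 := hb a (by simp [D, h0])
      simp only [hr', Complex.ofReal_re] at h2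
      rw [h0, hr']
      simpa [abs_of_nonneg hr] using h2
  have h9 := hdecδ b hbz
  have h10 : ‖z i ≫ A.one‖ ^ 2 ≤ ‖z i ≫ A.one ≫ (t : CEnd A.obj)‖ ^ 2 := by gcongr
  linarith

end Alg

/-! ### Balancing states and minimality of solutions -/

namespace Alg

variable {B : Type u} [Bicategory.{w, v} B] [CStarBicategory B] {M : B} {A : Alg M}

/-- At an optimal algebra each component has a balancing state, a convex combination of characters
attaining the norm. The first-order condition makes it vanish on `ι* s ι` for selfadjoint `s` with
`leftAverage s = 0`, and `x - leftAverage x` is a combination of two such `s`. -/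
lemma exists_isBalancingState (hA : A.IsCStarFrobenius) (hs : A.IsSpecial)
    (hfin : FiniteDimensional ℂ (𝟙 M ⟶ 𝟙 M)) {n : ℕ} {z : Fin n → (𝟙 M ⟶ 𝟙 M)}
    (hz : IsCentralPartition A.obj z)
    (hopt : ∀ t v, A.IsSpecialTwist t v → ∑ i, ‖z i ≫ A.one‖ ≤ ∑ i, ‖z i ≫ A.one ≫ t‖)
    (i : Fin n) : ∃ φ, IsBalancingState A (z i) φ := by
  classical
  have : FiniteDimensional ℂ (CEnd (𝟙 M)) := hfin
  obtain ⟨k, e, χ, he, hinj, hnorm⟩ := exists_minimal_projections (CEnd (𝟙 M))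
  let D := {a : Fin k // χ a (z i) = 1 ∧ (χ a (A.one ≫ A.one†)).re = ‖z i ≫ A.one‖ ^ 2}
  let W : Submodule ℝ (A.obj ⟶ A.obj) :=
    { carrier := {s | A.IsRightLinear s ∧ s† = s ∧ A.leftAverage s = 0}
      zero_mem' := ⟨(rightLinearEnd hA hs).zero_mem, dagger_zero _ _, A.leftAverageₗ.map_zero⟩
      add_mem' := fun {s s'} h h' => ⟨(rightLinearEnd hA hs).add_mem h.1 h'.1, by
        rw [CStarCategory.dagger_add, h.2.1, h'.2.1], by
        have := A.leftAverageₗ.map_add s s'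
        change A.leftAverage _ = A.leftAverage _ + A.leftAverage _ at this
        rw [this, h.2.2, h'.2.2, add_zero]⟩
      smul_mem' := fun c s h => ⟨(rightLinearEnd hA hs).smul_mem h.1 (c : ℂ), by
        change ((c : ℂ) • s)† = (c : ℂ) • s
        rw [CStarCategory.dagger_smul, h.2.1, Complex.conj_ofReal], by
        have := A.leftAverageₗ.map_smul (c : ℂ) s
        change A.leftAverage ((c : ℂ) • s) = _ • A.leftAverage _ at this
        change A.leftAverage ((c : ℂ) • s) = 0
        rw [this, h.2.2, smul_zero]⟩ }
  let F : (A.obj ⟶ A.obj) →ₗ[ℂ] CEnd (𝟙 M) :=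
    { toFun := fun x => A.one ≫ x ≫ A.one†
      map_add' := fun x y => by simp only [Preadditive.comp_add, Preadditive.add_comp]
      map_smul' := fun c x => by simp only [Linear.comp_smul, Linear.smul_comp]; rfl }
  let l : D → W →ₗ[ℝ] ℝ := fun a =>
    Complex.reLm ∘ₗ (((χ a).toAlgHom.toLinearMap ∘ₗ F).restrictScalars ℝ) ∘ₗ W.subtype
  have hl : ∀ a (s : W), l a s = (χ a (A.one ≫ (s : A.obj ⟶ A.obj) ≫ A.one†)).re :=
    fun a s => rfl
  obtain ⟨c, hc0, hc1, hc⟩ := gordan l (fun s => by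
    obtain ⟨a, h1, h2, h3⟩ := exists_char_nonpos hA hs hfin hz hopt χ hinj hnorm i s.1
      s.2.1 s.2.2.1 s.2.2.2
    exact ⟨⟨a, h1, h2⟩, h3⟩)
  let φ : CEnd (𝟙 M) →ₗ[ℂ] ℂ := ∑ a, (c a : ℂ) • (χ (a : D)).toAlgHom.toLinearMap
  have hφ : ∀ x, φ x = ∑ a, (c a : ℂ) * χ (a : D) x := fun x => by simp [φ]
  have hself : ∀ s ∈ W, φ (F s) = 0 := by
    intro s hsW
    have h1 : ∀ a, χ a (F s) = ((χ a (F s)).re : ℂ) := fun a => by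
      refine Complex.ext rfl ?_
      rw [Complex.ofReal_im]
      refine im_char_eq_zero (χ a) _ ?_
      change (A.one ≫ s ≫ A.one†)† = _
      simp [hsW.2.1]; rfl
    have h2 := hc ⟨s, hsW⟩
    rw [hφ, Finset.sum_congr rfl fun a _ => by rw [h1 a]]
    exact_mod_cast h2
  refine ⟨φ, ?_, ?_, ?_, ?_, ?_⟩
  · intro Y y
    choose r hr hr' using fun a => exists_nonneg_eq (χ a) y
    refine ⟨∑ a : D, c a * r a, Finset.sum_nonneg fun a _ => mul_nonneg (hc0 a) (hr a), ?_⟩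
    rw [hφ]
    push_cast
    exact Finset.sum_congr rfl fun a _ => by rw [hr']
  · intro x
    rw [hφ]
    calc _ ≤ ∑ a : D, ‖(c a : ℂ) * χ a x‖ := norm_sum_le _ _
      _ ≤ ∑ a : D, c a * ‖x‖ := by
        refine Finset.sum_le_sum fun a _ => ?_
        rw [norm_mul, Complex.norm_real, Real.norm_of_nonneg (hc0 a)]
        exact mul_le_mul_of_nonneg_left (NonUnitalStarAlgHom.norm_apply_le (χ a) x) (hc0 a)
      _ = ‖x‖ := by rw [← Finset.sum_mul, hc1, _root_.one_mul]
  · intro x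
    rw [hφ, hφ]
    refine Finset.sum_congr rfl fun a _ => ?_
    have : χ a (z i ≫ x) = χ a (z i) * χ a x := by rw [← map_mul]; rfl
    rw [this, a.2.1, _root_.one_mul]
  · rw [hφ]
    have h1 : ∀ a : D, χ a (A.one ≫ A.one†) = ((‖z i ≫ A.one‖ ^ 2 : ℝ) : ℂ) := fun a => by
      obtain ⟨r, hr, hr'⟩ := exists_nonneg_eq (χ a) A.one
      have := a.2.2
      rw [hr', Complex.ofReal_re] at this
      rw [hr', this]
    rw [Finset.sum_congr rfl fun a _ => by rw [h1 a], ← Finset.sum_mul]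
    have : ∑ a, (c a : ℂ) = 1 := by exact_mod_cast hc1
    rw [this, _root_.one_mul]
  · intro x hx
    let y : A.obj ⟶ A.obj := x - A.leftAverage x
    have hyr : A.IsRightLinear y :=
      (rightLinearEnd hA hs).sub_mem hx (hA.isRightLinear_leftAverage hx)
    have hy0 : A.leftAverageₗ y = 0 := by
      have h1 : A.leftAverage (A.leftAverage x) = A.leftAverage x :=
        (hA.isLeftLinear_leftAverage x).leftAverage_eq hs
      rw [map_sub]
      change A.leftAverage x - A.leftAverage (A.leftAverage x) = 0
      rw [h1, sub_self]
    have hyd0 : A.leftAverageₗ (y†) = 0 := by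
      change A.leftAverage (y†) = 0
      rw [← dagger_leftAverage]
      change (A.leftAverageₗ y)† = 0
      rw [hy0, dagger_zero]
    have hyrd : A.IsRightLinear (y†) := hA.dagger_right hs hyr
    -- the real and the imaginary part of `y` are in `W`
    have h1 : φ (F (y + y†)) = 0 := by
      refine hself _ ⟨(rightLinearEnd hA hs).add_mem hyr hyrd, ?_, ?_⟩
      · rw [CStarCategory.dagger_add, CStarCategory.dagger_dagger, add_comm]
      · change A.leftAverageₗ _ = 0
        rw [map_add, hy0, hyd0, add_zero]
    have h2 : φ (F (Complex.I • y + (Complex.I • y)†)) = 0 := by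
      refine hself _ ⟨(rightLinearEnd hA hs).add_mem ((rightLinearEnd hA hs).smul_mem hyr _)
        (hA.dagger_right hs ((rightLinearEnd hA hs).smul_mem hyr _)), ?_, ?_⟩
      · rw [CStarCategory.dagger_add, CStarCategory.dagger_dagger, add_comm]
      · change A.leftAverageₗ _ = 0
        rw [CStarCategory.dagger_smul, map_add, map_smul, map_smul, hy0, hyd0, smul_zero,
          smul_zero, add_zero]
    have h3 : φ (F y) = 0 := by
      rw [map_add, map_add] at h1
      rw [CStarCategory.dagger_smul, map_add, map_add, map_smul, map_smul, map_smul, map_smul,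
        Complex.conj_I, smul_eq_mul, smul_eq_mul] at h2
      have h4 : 2 * Complex.I * φ (F y) = 0 := by linear_combination h2 + Complex.I * h1
      simpa using h4
    rw [map_sub, map_sub] at h3
    exact sub_eq_zero.mp h3

/-- The two partial traces defined by `m* ι` agree under a balancing state. The balancing property
is used for `rightAverage T` and for the left multiplication by the element `leftAverage T ι`; the
two results coincide because `leftAverage` and `rightAverage` commute. -/
lemma IsBalancingState.rightAverage_eq_leftAverage (hA : A.IsCStarFrobenius)
    {z : 𝟙 M ⟶ 𝟙 M} {φ : (𝟙 M ⟶ 𝟙 M) →ₗ[ℂ] ℂ} (hφ : IsBalancingState A z φ)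
    (T : A.obj ⟶ A.obj) :
    φ (A.one ≫ A.rightAverage T ≫ A.one†) = φ (A.one ≫ A.leftAverage T ≫ A.one†) := by
  let U' := A.leftMul (A.one ≫ A.leftAverage T)
  have hU : A.one ≫ U' = A.one ≫ A.leftAverage T := one_leftMul _
  have h1 : A.leftAverage U' = A.rightAverage (A.leftAverage T) :=
    (hA.isLeftLinear_leftAverage T).leftAverage_leftMul
  rw [hφ.balanced _ (hA.isRightLinear_rightAverage T), leftAverage_rightAverage, ← h1,
    ← hφ.balanced U' (isRightLinear_leftMul _), reassoc_of% hU]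

end Alg

section Minimality

variable {B : Type u} [Bicategory.{w, v} B] [CStarBicategory B] {M : B} {Y Yd : M ⟶ M}

/-- The Cauchy-Schwarz inequality for a positive functional on the center. -/
lemma norm_sq_le_of_nonneg {φ : (𝟙 M ⟶ 𝟙 M) →ₗ[ℂ] ℂ}
    (hφ : ∀ {Y : M ⟶ M} (y : 𝟙 M ⟶ Y), ∃ r : ℝ, 0 ≤ r ∧ φ (y ≫ y†) = r)
    {X : M ⟶ M} (x y : 𝟙 M ⟶ X) :
    ‖φ (x ≫ y†)‖ ^ 2 ≤ (φ (x ≫ x†)).re * (φ (y ≫ y†)).re := by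
  have him : ∀ y : 𝟙 M ⟶ X, (φ (y ≫ y†)).im = 0 := fun y => by
    obtain ⟨r, -, hr⟩ := hφ y
    rw [hr, Complex.ofReal_im]
  -- polarization: the form is hermitian because it is real on the diagonal
  have hconj : ∀ x y : 𝟙 M ⟶ X, (starRingEnd ℂ) (φ (x ≫ y†)) = φ (y ≫ x†) := by
    intro x y
    have h1 := him (x + y)
    have h2 := him (x + Complex.I • y)
    simp only [CStarCategory.dagger_add, CStarCategory.dagger_smul, Preadditive.add_comp,
      Preadditive.comp_add, Linear.smul_comp, Linear.comp_smul, map_add, map_smul, Complex.conj_I,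
      Complex.add_im, Complex.add_re, him, smul_eq_mul, Complex.mul_im, Complex.mul_re,
      Complex.I_re, Complex.I_im, Complex.neg_re, Complex.neg_im] at h1 h2
    apply Complex.ext
    · simp only [Complex.conj_re]; linarith
    · simp only [Complex.conj_im]; linarith
  let c : PreInnerProductSpace.Core ℂ (𝟙 M ⟶ X) :=
    { inner := fun x y => φ (y ≫ x†)
      conj_inner_symm := fun x y => hconj x y
      re_inner_nonneg := fun x => by
        obtain ⟨r, hr, hr'⟩ := hφ x
        simpa [hr'] using hr
      add_left := fun x y w => by
        simp only [CStarCategory.dagger_add, Preadditive.comp_add, map_add]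
      smul_left := fun x y r => by
        simp only [CStarCategory.dagger_smul, Linear.comp_smul, map_smul, smul_eq_mul] }
  have h := InnerProductSpace.Core.inner_mul_inner_self_le (c := c) y x
  change ‖φ (x ≫ y†)‖ * ‖φ (y ≫ x†)‖ ≤ (φ (y ≫ y†)).re * (φ (x ≫ x†)).re at h
  rw [← hconj x y, RCLike.norm_conj] at h
  rw [sq, mul_comm (φ (x ≫ x†)).re]
  exact h

/-- A solution whose partial traces agree under a contractive positive functional attaining its norm
has the least product of norms among all solutions. -/
lemma IsConjugateSolution.norm_sq_le {g : 𝟙 M ⟶ Y ≫ Yd} {g' : 𝟙 M ⟶ Yd ≫ Y}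
    (h : IsConjugateSolution Y Yd g g') {φ : (𝟙 M ⟶ 𝟙 M) →ₗ[ℂ] ℂ}
    (hφ : ∀ {Y : M ⟶ M} (y : 𝟙 M ⟶ Y), ∃ r : ℝ, 0 ≤ r ∧ φ (y ≫ y†) = r)
    (hnorm : ∀ x, ‖φ x‖ ≤ ‖x‖) (hatt : φ (g ≫ g†) = (‖g‖ ^ 2 : ℝ))
    (htr : ∀ T : Y ⟶ Y, φ (g ≫ T ▷ Yd ≫ g†) = φ (g' ≫ Yd ◁ T ≫ g'†))
    {ω : 𝟙 M ⟶ Y ≫ Yd} {ω' : 𝟙 M ⟶ Yd ≫ Y} (hω : IsConjugateSolution Y Yd ω ω') :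
    ‖g‖ ^ 2 ≤ ‖ω‖ * ‖ω'‖ := by
  -- the endomorphism comparing the two solutions
  let s : Y ⟶ Y := (λ_ Y).inv ≫ g ▷ Y ≫ (α_ Y Yd Y).hom ≫ Y ◁ ω'† ≫ (ρ_ Y).hom
  have hs1 : ω ≫ s ▷ Yd = g := by
    calc ω ≫ s ▷ Yd = 𝟙 _ ⊗≫ (𝟙 M ◁ ω ≫ g ▷ (Y ≫ Yd)) ⊗≫ Y ◁ ω'† ▷ Yd ⊗≫ 𝟙 _ := by
          simp only [s]; bicategory
      _ = g ⊗≫ Y ◁ (Yd ◁ ω ⊗≫ ω'† ▷ Yd) ⊗≫ 𝟙 _ := by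
          rw [whisker_exchange]; bicategory
      _ = g ⊗≫ Y ◁ ((ρ_ Yd).hom ≫ ((ρ_ Yd).inv ≫ Yd ◁ ω ≫ (α_ Yd Y Yd).inv ≫ ω'† ▷ Yd ≫
            (λ_ Yd).hom) ≫ (λ_ Yd).inv) ⊗≫ 𝟙 _ := by
          bicategory
      _ = g := by rw [hω.right]; bicategory
  have hs2 : Yd ◁ s ≫ g'† = ω'† := by
    calc Yd ◁ s ≫ g'† = 𝟙 _ ⊗≫ Yd ◁ g ▷ Y ⊗≫ ((Yd ≫ Y) ◁ ω'† ≫ g'† ▷ 𝟙 M) ⊗≫ 𝟙 _ := by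
          simp only [s]; bicategory
      _ = 𝟙 _ ⊗≫ (Yd ◁ g ⊗≫ g'† ▷ Yd) ▷ Y ⊗≫ ω'† := by
          rw [whisker_exchange]; bicategory
      _ = 𝟙 _ ⊗≫ ((ρ_ Yd).hom ≫ ((ρ_ Yd).inv ≫ Yd ◁ g ≫ (α_ Yd Y Yd).inv ≫ g'† ▷ Yd ≫
            (λ_ Yd).hom) ≫ (λ_ Yd).inv) ▷ Y ⊗≫ ω'† := by
          bicategory
      _ = ω'† := by rw [h.right]; bicategory
  -- Cauchy-Schwarz is applied to `ω` and `x`: their product is `g* g`, and the trace condition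
  -- turns the squared length of `x` into that of `ω'`
  let x : 𝟙 M ⟶ Y ≫ Yd := g ≫ s† ▷ Yd
  have h1 : ω ≫ x† = g ≫ g† := by
    have h0 : x† = s ▷ Yd ≫ g† := by simp [x]
    rw [h0, reassoc_of% hs1]
  have h2 : φ (x ≫ x†) = φ (ω' ≫ ω'†) := by
    have h3 : x ≫ x† = g ≫ (s† ≫ s) ▷ Yd ≫ g† := by simp [x]
    have h4 : g' ≫ Yd ◁ (s† ≫ s) ≫ g'† = ω' ≫ ω'† := by
      have h5 : g' ≫ Yd ◁ s† = ω' := by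
        simpa using congrArg CStarCategory.dagger hs2
      rw [whiskerLeft_comp, Category.assoc, reassoc_of% h5, hs2]
    rw [h3, htr, h4]
  have h3 := norm_sq_le_of_nonneg hφ ω x
  rw [h1, h2, hatt] at h3
  have h4 : ∀ {X : M ⟶ M} (y : 𝟙 M ⟶ X), (φ (y ≫ y†)).re ≤ ‖y‖ ^ 2 := fun y => by
    rw [← CStarCategory.norm_comp_dagger]
    exact (Complex.re_le_norm _).trans (hnorm _)
  have h5 : 0 ≤ (φ (ω' ≫ ω'†)).re := by
    obtain ⟨r, hr, hr'⟩ := hφ ω'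
    rw [hr']; simpa using hr
  have h6 : (‖g‖ ^ 2) ^ 2 ≤ (‖ω‖ * ‖ω'‖) ^ 2 := by
    calc (‖g‖ ^ 2) ^ 2 = ‖((‖g‖ ^ 2 : ℝ) : ℂ)‖ ^ 2 := by
          rw [Complex.norm_real, Real.norm_of_nonneg (sq_nonneg _)]
      _ ≤ _ := h3
      _ ≤ ‖ω‖ ^ 2 * ‖ω'‖ ^ 2 := mul_le_mul (h4 _) (h4 _) h5 (sq_nonneg _)
      _ = _ := by ring
  exact le_of_sq_le_sq h6 (by positivity)

end Minimality

/-! ### Compression to the components -/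

section Horizontal

variable {B : Type u} [Bicategory.{w, v} B]

lemma hTensor_comp {a b c : B} {Y₁ Y₂ Y₃ : b ⟶ c} {X₁ X₂ X₃ : a ⟶ b} (t : Y₁ ⟶ Y₂)
    (t' : Y₂ ⟶ Y₃) (s : X₁ ⟶ X₂) (s' : X₂ ⟶ X₃) :
    hTensor t s ≫ hTensor t' s' = hTensor (t ≫ t') (s ≫ s') := by
  simp [hTensor, whisker_exchange_assoc]

lemma whiskerRight_comp_hTensor {a b c : B} {Y₁ Y₂ : b ⟶ c} {X₁ X₂ X₃ : a ⟶ b} (t : Y₁ ⟶ Y₂)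
    (s : X₁ ⟶ X₂) (s' : X₂ ⟶ X₃) :
    s ▷ Y₁ ≫ hTensor t s' = hTensor t (s ≫ s') := by
  simp [hTensor]

lemma whiskerLeft_comp_hTensor {a b c : B} {Y₁ Y₂ Y₃ : b ⟶ c} {X₁ X₂ : a ⟶ b} (t : Y₁ ⟶ Y₂)
    (t' : Y₂ ⟶ Y₃) (s : X₁ ⟶ X₂) :
    X₁ ◁ t ≫ hTensor t' s = hTensor (t ≫ t') s := by
  simp [hTensor, whisker_exchange_assoc]

end Horizontal

section Compression

variable {B : Type u} [Bicategory.{w, v} B] [CStarBicategory B] {M : B} {X Y : M ⟶ M}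

@[simp]
lemma dagger_hTensor {a b c : B} {Y₁ Y₂ : b ⟶ c} {X₁ X₂ : a ⟶ b} (t : Y₁ ⟶ Y₂) (s : X₁ ⟶ X₂) :
    (hTensor t s)† = hTensor (t†) (s†) := by
  simp [hTensor, whisker_exchange]

/-- Solutions of the conjugate equations restrict to the range of a projection that may be moved
from one leg of the solution to the other. -/
lemma IsConjugateSolution.compress {ω : 𝟙 M ⟶ X ≫ X} (h : IsConjugateSolution X X ω ω)
    (u : Y ⟶ X) (hu : u ≫ u† = 𝟙 Y)
    (hp : (u† ≫ u) ▷ X ≫ ω† = X ◁ (u† ≫ u) ≫ ω†) :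
    IsConjugateSolution Y Y (ω ≫ hTensor (u†) (u†)) (ω ≫ hTensor (u†) (u†)) := by
  have hup : u ≫ u† ≫ u = u := by rw [reassoc_of% hu]
  have e1 : u† ▷ Y ≫ hTensor u u ≫ ω† = X ◁ u ≫ ω† := by
    calc _ = X ◁ u ≫ (u† ≫ u) ▷ X ≫ ω† := by
          rw [← Category.assoc, whiskerRight_comp_hTensor, hTensor, whisker_exchange_assoc]; simp
      _ = _ := by rw [hp, ← whiskerLeft_comp_assoc, hup]
  have e2 : Y ◁ u† ≫ hTensor u u ≫ ω† = u ▷ X ≫ ω† := by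
    calc _ = u ▷ X ≫ X ◁ (u† ≫ u) ≫ ω† := by
          rw [← Category.assoc, whiskerLeft_comp_hTensor, hTensor]; simp
      _ = _ := by rw [← hp, ← comp_whiskerRight_assoc, hup]
  constructor
  · calc _ = (λ_ Y).inv ≫ ω ▷ Y ⊗≫ (u† ▷ (X ≫ Y) ≫ Y ◁ (u† ▷ Y ≫ hTensor u u ≫ ω†)) ⊗≫ 𝟙 _ := by
          simp only [CStarCategory.dagger_comp, dagger_hTensor, CStarCategory.dagger_dagger]
          simp only [hTensor]
          bicategory
      _ = 𝟙 _ ⊗≫ (ω ▷ Y ≫ (X ≫ X) ◁ u) ⊗≫ X ◁ ω† ⊗≫ u† := by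
          rw [e1, ← whisker_exchange]; bicategory
      _ = u ≫ ((λ_ X).inv ≫ ω ▷ X ≫ (α_ X X X).hom ≫ X ◁ ω† ≫ (ρ_ X).hom) ≫ u† := by
          rw [← whisker_exchange]; bicategory
      _ = _ := by rw [h.left, Category.id_comp, hu]
  · calc _ = (ρ_ Y).inv ≫ Y ◁ ω ⊗≫ ((Y ≫ X) ◁ u† ≫ (Y ◁ u† ≫ hTensor u u ≫ ω†) ▷ Y) ⊗≫ 𝟙 _ := by
          have hex : hTensor (u†) (u†) = X ◁ u† ≫ u† ▷ Y := by rw [hTensor, whisker_exchange]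
          simp only [CStarCategory.dagger_comp, dagger_hTensor, CStarCategory.dagger_dagger]
          simp only [hex]
          simp only [hTensor]
          bicategory
      _ = 𝟙 _ ⊗≫ (Y ◁ ω ≫ u ▷ (X ≫ X)) ⊗≫ ω† ▷ X ⊗≫ u† := by
          rw [e2, whisker_exchange]; bicategory
      _ = u ≫ ((ρ_ X).inv ≫ X ◁ ω ≫ (α_ X X X).inv ≫ ω† ▷ X ≫ (λ_ X).hom) ≫ u† := by
          rw [whisker_exchange]; bicategory
      _ = _ := by rw [h.right, Category.id_comp, hu]

end Compression

namespace Alg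

section Transport

variable {B : Type u} [Bicategory.{w, v} B] [CStarBicategory B] {M : B} {A : Alg M}

/-- Special twists compose. -/
lemma IsSpecialTwist.trans {t v t' v' : A.obj ⟶ A.obj} (h : A.IsSpecialTwist t v)
    (h' : (A.transport t v h.right h.right_inv h.inv_comp h.comp_inv).IsSpecialTwist t' v') :
    A.IsSpecialTwist (t ≫ t') (v' ≫ v) := by
  have h1 : t' ≫ v' = 𝟙 A.obj := h'.comp_inv
  have h2 : v' ≫ t' = 𝟙 A.obj := h'.inv_comp
  refine ⟨h.right.comp (isRightLinear_transport_iff.mp h'.right),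
    (isRightLinear_transport_iff.mp h'.right_inv).comp h.right_inv, ?_, ?_, ?_⟩
  · rw [Category.assoc, reassoc_of% h1, h.comp_inv]
  · rw [Category.assoc, reassoc_of% h.inv_comp, h2]
  · have h3 : A.leftAverage _ = 𝟙 A.obj := (leftAverage_transport (v'† ≫ v')).symm.trans h'.special
    rw [← h3]
    simp

end Transport

variable {B : Type u} [Bicategory.{w, v} B] [CStarBicategory B] {M : B} {A : Alg M}

/-- A special C*-Frobenius algebra with balancing states for its connected components is standard.
The components are the ranges of the projections by which the `z i` act on `A`; they
are self-dual. -/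
lemma isStandardSolution_of_isBalancingState (hA : A.IsCStarFrobenius) (hs : A.IsSpecial) {n : ℕ}
    {z : Fin n → (𝟙 M ⟶ 𝟙 M)} (hz : IsCentralPartition A.obj z)
    (hbal : ∀ i, ∃ φ, IsBalancingState A (z i) φ) :
    IsStandardSolution A.obj A.obj (A.one ≫ A.mul†) (A.one ≫ A.mul†) := by
  let ω : 𝟙 M ⟶ A.obj ≫ A.obj := A.one ≫ A.mul†
  have hω : IsConjugateSolution A.obj A.obj ω ω := hA.isConjugateSolution
  let p : Fin n → (A.obj ⟶ A.obj) := fun i => sourceAct A.obj (z i)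
  have hpt : ∀ i, p i = targetAct A.obj (z i) := hz.balanced
  have hpp : ∀ i, p i ≫ p i = p i := fun i => by
    simp only [p]; rw [← sourceAct_comp, hz.idem]
  have hzero : sourceAct A.obj (0 : 𝟙 M ⟶ 𝟙 M) = 0 := by
    have := sourceAct_smul A.obj (0 : ℂ) 0
    simpa using this
  have hpo : ∀ i j, i ≠ j → p i ≫ p j = 0 := fun i j hij => by
    simp only [p]; rw [← sourceAct_comp, hz.orthogonal i j hij, hzero]
  have hpd : ∀ i, (p i)† = p i := fun i => by
    simp only [p]; rw [dagger_sourceAct, hz.dagger]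
  have hpl : ∀ i, A.mul ≫ p i = p i ▷ A.obj ≫ A.mul := fun i => isLeftLinear_sourceAct A (z i)
  have hpr : ∀ i, A.mul ≫ p i = A.obj ◁ p i ≫ A.mul := fun i => by
    rw [hpt]; exact isRightLinear_targetAct A (z i)
  have hωl : ∀ i, ω ≫ p i ▷ A.obj = z i ≫ ω := fun i => by
    have h1 : p i ≫ A.mul† = A.mul† ≫ p i ▷ A.obj := by
      simpa [hpd] using congrArg CStarCategory.dagger (hpl i)
    simp only [ω, Category.assoc]
    rw [← h1, ← Category.assoc, comp_sourceAct, Category.assoc]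
  have hωr : ∀ i, ω ≫ A.obj ◁ p i = z i ≫ ω := fun i => by
    have h1 : p i ≫ A.mul† = A.mul† ≫ A.obj ◁ p i := by
      simpa [hpd] using congrArg CStarCategory.dagger (hpr i)
    simp only [ω, Category.assoc]
    rw [← h1, ← Category.assoc, comp_sourceAct, Category.assoc]
  choose Y u hu hup using fun i =>
    CStarBicategory.subobjects M M A.obj (p i) (hpp i) (hpd i)
  have huu : ∀ i, u i ≫ p i = u i := fun i => by rw [← hup, reassoc_of% (hu i)]
  have huo : ∀ i j, i ≠ j → u i ≫ p j = 0 := fun i j hij => by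
    rw [← huu i, Category.assoc, hpo i j hij, Limits.comp_zero]
  have hsum : ∑ i, p i = 𝟙 A.obj := by
    have h1 := map_sum (AddMonoidHom.mk' (sourceAct A.obj) (sourceAct_add A.obj)) z Finset.univ
    rw [hz.sum_eq] at h1
    exact h1.symm.trans (sourceAct_id _)
  have hdirect : IsDirectSum Y A.obj u := by
    refine ⟨hu, fun i j hij => ?_, ?_⟩
    · have : (u j)† = p j ≫ (u j)† := by
        have := congrArg CStarCategory.dagger (huu j)
        rw [CStarCategory.dagger_comp, hpd] at this
        exact this.symm
      rw [this, ← Category.assoc, huo i j hij, Limits.zero_comp]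
    · rw [← hsum]; exact Finset.sum_congr rfl fun i _ => hup i
  -- `z j` acts as the identity from the right on `Y j` and as zero from the left on `Y i`
  have hcomp0 : ∀ i j, i ≠ j → Limits.IsZero (Y j ≫ Y i) := by
    intro i j hij
    rw [Limits.IsZero.iff_id_eq_zero]
    have h1 : targetAct (Y j) (z j) = 𝟙 _ := by
      calc _ = targetAct (Y j) (z j) ≫ u j ≫ (u j)† := by rw [hu, Category.comp_id]
        _ = _ := by rw [targetAct_naturality_assoc, ← hpt, reassoc_of% (huu j), hu]
    have h2 : sourceAct (Y i) (z j) = 0 := by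
      calc _ = sourceAct (Y i) (z j) ≫ u i ≫ (u i)† := by rw [hu, Category.comp_id]
        _ = _ := by
          rw [sourceAct_naturality_assoc, ← Category.assoc, huo i j hij, Limits.zero_comp]
    have h3 := targetAct_whiskerRight (Y j) (Y i) (z j)
    have h4 : Y j ◁ (0 : Y i ⟶ Y i) = 0 := by
      have := CStarBicategory.whiskerLeft_smul (Y j) (0 : ℂ) (0 : Y i ⟶ Y i)
      simpa using this
    rw [h1, h2, id_whiskerRight, h4] at h3
    exact h3
  let g : ∀ i, 𝟙 M ⟶ Y i ≫ Y i := fun i => ω ≫ hTensor ((u i)†) ((u i)†)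
  have hωd : ω† = A.mul ≫ A.one† := by simp [ω]
  have htr1 : ∀ i (T : Y i ⟶ Y i), g i ≫ T ▷ Y i ≫ (g i)† =
      z i ≫ A.one ≫ A.leftAverage ((u i)† ≫ T ≫ u i) ≫ A.one† := by
    intro i T
    calc _ = (ω ≫ A.obj ◁ p i) ≫ ((u i)† ≫ T ≫ u i) ▷ A.obj ≫ ω† := by
          simp only [g, CStarCategory.dagger_comp, dagger_hTensor, CStarCategory.dagger_dagger,
            Category.assoc]
          rw [← Category.assoc (T ▷ _), whiskerRight_comp_hTensor,
            ← Category.assoc (hTensor _ _), hTensor_comp, hup, hTensor, ← whisker_exchange]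
          simp
      _ = _ := by rw [hωr, hωd]; simp [leftAverage, ω]
  have htr2 : ∀ i (T : Y i ⟶ Y i), g i ≫ Y i ◁ T ≫ (g i)† =
      z i ≫ A.one ≫ A.rightAverage ((u i)† ≫ T ≫ u i) ≫ A.one† := by
    intro i T
    calc _ = (ω ≫ p i ▷ A.obj) ≫ A.obj ◁ ((u i)† ≫ T ≫ u i) ≫ ω† := by
          simp only [g, CStarCategory.dagger_comp, dagger_hTensor, CStarCategory.dagger_dagger,
            Category.assoc]
          rw [← Category.assoc (_ ◁ T), whiskerLeft_comp_hTensor,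
            ← Category.assoc (hTensor _ _), hTensor_comp, hup, hTensor]
          simp
      _ = _ := by rw [hωl, hωd]; simp [rightAverage, ω]
  have hgg : ∀ i, g i ≫ (g i)† = z i ≫ A.one ≫ A.one† := by
    intro i
    have h1 := htr1 i (𝟙 _)
    have hpl' : A.IsLeftLinear (p i) := hpl i
    rw [id_whiskerRight, Category.id_comp, Category.id_comp, hup, hpl'.leftAverage_eq hs] at h1
    rw [h1, ← Category.assoc A.one, comp_sourceAct, Category.assoc, ← Category.assoc, hz.idem]
  have hsol : ∀ i, IsConjugateSolution (Y i) (Y i) (g i) (g i) := by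
    intro i
    refine hω.compress (u i) (hu i) ?_
    rw [hup, hωd, ← Category.assoc, ← hpl, hpr, Category.assoc]
  have hconn : ∀ i, IsConnected (Y i) := by
    intro i
    apply Set.Subset.antisymm
    · rintro T ⟨⟨y, hy⟩, ⟨y', hy'⟩⟩
      have hy : sourceAct (Y i) y = T := hy
      have hy' : targetAct (Y i) y' = T := hy'
      have h1 : (u i)† ≫ T ≫ u i = sourceAct A.obj (z i ≫ y) := by
        rw [← hy, sourceAct_naturality, reassoc_of% (hup i), ← sourceAct_comp]
      have h2 : (u i)† ≫ T ≫ u i = targetAct A.obj (z i ≫ y') := by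
        rw [← hy', targetAct_naturality, reassoc_of% (hup i), hpt, ← targetAct_comp]
      obtain ⟨c, hc⟩ := hz.minimal i (z i ≫ y) (sourceAct_eq_targetAct_of_eq (h1.symm.trans h2))
      rw [← Category.assoc, hz.idem] at hc
      refine ⟨c, ?_⟩
      rw [hc, sourceAct_smul] at h1
      have h3 : T = u i ≫ ((u i)† ≫ T ≫ u i) ≫ (u i)† := by
        simp only [Category.assoc]
        rw [hu, Category.comp_id, reassoc_of% (hu i)]
      change c • 𝟙 (Y i) = T
      rw [h3, h1, Linear.smul_comp, Linear.comp_smul, reassoc_of% (huu i), hu]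
    · rintro T ⟨c, rfl⟩
      refine ⟨⟨c • 𝟙 _, ?_⟩, ⟨c • 𝟙 _, ?_⟩⟩
      · change sourceAct (Y i) (c • 𝟙 _) = c • 𝟙 _
        rw [sourceAct_smul, sourceAct_id]
      · change targetAct (Y i) (c • 𝟙 _) = c • 𝟙 _
        rw [targetAct_smul, targetAct_id]
  have hsumg : ω = ∑ i, g i ≫ hTensor (u i) (u i) := by
    have h1 : ∀ i, g i ≫ hTensor (u i) (u i) = z i ≫ ω := by
      intro i
      simp only [g, Category.assoc]
      rw [hTensor_comp, hup, hTensor, ← Category.assoc, hωl, Category.assoc, hωr,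
        ← Category.assoc, hz.idem]
    rw [Finset.sum_congr rfl fun i _ => h1 i, ← Preadditive.sum_comp, hz.sum_eq,
      Category.id_comp]
  refine ⟨hω, n, Y, Y, u, u, g, g, hdirect, hdirect, fun i j hij => ⟨hcomp0 i j hij,
    hcomp0 j i hij.symm⟩, fun i => ⟨hconn i, hsol i, rfl, ?_⟩, hsumg, hsumg⟩
  obtain ⟨φ, hφ⟩ := hbal i
  refine IsLeast.isGLB ⟨⟨g i, g i, hsol i, sq _⟩, ?_⟩
  rintro _ ⟨γ, γ', hγ, rfl⟩
  refine (hsol i).norm_sq_le (φ := φ) hφ.nonneg hφ.norm_le ?_ (fun T => ?_) hγ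
  · have h1 : ‖g i‖ ^ 2 = ‖z i ≫ A.one‖ ^ 2 := by
      rw [← CStarCategory.norm_comp_dagger, ← CStarCategory.norm_comp_dagger, hgg]
      have : (z i ≫ A.one) ≫ (z i ≫ A.one)† = (z i ≫ z i) ≫ A.one ≫ A.one† := by
        rw [CStarCategory.dagger_comp, hz.dagger, Category.assoc, ← Category.assoc A.one,
          unit_comp_comm (A.one ≫ A.one†), Category.assoc]
      rw [this, hz.idem]
    rw [hgg, hφ.absorb, hφ.attained, h1]
  · rw [htr1, htr2, hφ.absorb, hφ.absorb, hφ.rightAverage_eq_leftAverage hA]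

end Alg

end CStarBicat

theorem mainTheorem9 {B : Type u} [Bicategory.{w, v} B] [CStarBicat.CStarBicategory B]
    (hrigid : CStarBicat.IsRigid B) (hfin : CStarBicat.HasFiniteDimensionalCenters B)
    {M : B} (A : CStarBicat.Alg M) (hA : A.IsCStarFrobenius) (hspecial : A.IsSpecial) :
    (∃ t : A.obj ≅ A.obj,
      CStarBicat.Bimod.IsMap A.rightBimod A.rightBimod t.hom ∧
      CStarBicat.IsStandardSolution A.obj A.obj (A.twisted t) (A.twisted t)) ∧
    ∃ A' : CStarBicat.Alg M, A'.IsStandard ∧ A.Isomorphic A' := by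
  obtain ⟨n, z, hz⟩ := CStarBicat.exists_isCentralPartition (hfin M) A.obj
  obtain ⟨t, v, htw, hopt⟩ := CStarBicat.Alg.exists_optimal_twist hA hspecial (hfin M) hz
  let A' := A.transport t v htw.right htw.right_inv htw.inv_comp htw.comp_inv
  have hA' : A'.IsCStarFrobenius := hA.transport hspecial
  have hs' : A'.IsSpecial := CStarBicat.Alg.isSpecial_transport htw.special
  have hopt' : ∀ t' v' : A.obj ⟶ A.obj, A'.IsSpecialTwist t' v' →
      ∑ i, ‖z i ≫ A'.one‖ ≤ ∑ i, ‖z i ≫ A'.one ≫ t'‖ := by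
    intro t' v' h
    have h1 := hopt _ _ (htw.trans h)
    have h2 : ∀ i, z i ≫ A'.one ≫ t' = z i ≫ A.one ≫ t ≫ t' := fun i =>
      congrArg (z i ≫ ·) (Category.assoc A.one t t')
    simp only [h2]
    exact h1
  have hstd : CStarBicat.IsStandardSolution A.obj A.obj (A'.one ≫ A'.mul†) (A'.one ≫ A'.mul†) :=
    CStarBicat.Alg.isStandardSolution_of_isBalancingState (A := A') hA' hs' hz fun i =>
      CStarBicat.Alg.exists_isBalancingState (A := A') hA' hs' (hfin M) hz hopt' i
  refine ⟨⟨⟨t, v, htw.comp_inv, htw.inv_comp⟩, ⟨?_, htw.right⟩, ?_⟩, A', ⟨hA', hs', hstd⟩,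
    ⟨t, v, htw.comp_inv, htw.inv_comp⟩, CStarBicat.Alg.isHom_transport⟩
  · exact (rightUnitor_naturality t).symm
  · rw [← CStarBicat.Alg.one_mul_dagger_transport (ht := htw.right) (hv := htw.right_inv)
      hA hspecial]
    exact hstd
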